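/- **Setting.** Let $n,k\ge 1$, $N=2^n$, let $D=\langle d_x\rangle_{x\in\{0,1\}^n}$ be a database with $d_x\in\{0,1\}^k$, let $f:\{0,1\}^k\to\{0,1\}$, and put $s=f(D)=\frac1N\sum_x f(d_x)$. Let $T=2^t$, $p\in(0,1)$ and $s_{\min}>0$. Put $O_D|x\rangle|\tau\rangle=|x\rangle|\tau\oplus d_x\rangle$, $U_D(y)=(X^y\otimes I)O_D(X^y\otimes I)$, $U_g|x\rangle|\tau\rangle=(-1)^{g(\tau)}|x\rangle|\tau\rangle$, $U'_f|x\rangle|\tau\rangle|b\rangle=|x\rangle|\tau\rangle|b\oplus f(\tau)\rangle$, $\bar G=(I-2|+\rangle^{\otimes n}\langle+|^{\otimes n})\otimes I$, and $Q_g(y)=\bar G\,U_D(y)\,U_g\,U_D(y)$. **Strategies.** The control qubits are $C_0,\dots,C_{t-1}$, with $C_0$ the most significant. Of the rounds $0,\dots,T-1$, rounds $1,\dots,2^{t-1}$ belong to $C_0$, the next $2^{t-2}$ to $C_1$, and so on; round $0$ belongs to no control qubit. Functions $f_0,\dots,f_{T-1}:\{0,1\}^k\to\{0,1\}$ form a *strategy*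 for computing $f(D)$ if either all $f_i=f$ (trivial strategy), or there is a confusing qubit $C_u$, $u<t-1$, such that, for every $y$: for $w<u$ the product of the $Q_{f_i}(y)$ over the rounds of $C_w$ (in order of application) is $Q_f(y)^{2^{t-w-2}}$; for $C_u$ this product is the identity; and $f_i=f$ in all rounds of the $C_w$ with $w>u$ (nontrivial strategy). **Protocol with honest Alice and Bob.** Alice draws $y\in\{0,1\}^n$ uniformly. Bob prepares two copies of $|+\rangle^{\otimes t}|+\rangle^{\otimes n}|0\rangle^{\otimes k}$ (control, address and data registers), each with an ancilla $|0\rangle$. In round $i=0,\dots,T-1$, on each copy, Alice applies $U_D(y)$, Bob controlled $U_{f_i}$, Alice $U_D(y)$, Bob controlled $\bar G$, where the control is the qubit to which round $i$ belongs (in round $0$ nothing is activated). After the rounds, on each copy Alice applies $U_D(y)$, Bob $U'_f$ and Alice $U_D(y)$. Bob measures the ancilla, performs the quantum Fourier transform on the control qubits (on all of them for the trivial strategy, on all but $C_u$ for a nontrivial one), and measures them, with result $\theta_i$ for copy $i\in\{1,2\}$. He outputs $s_i=\cos^2(\theta_i\pi/T')$, where $T'=T$ for the trivial and $T'=T/2$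 for a nontrivial strategy. **Tests.** In each round, and once in the final stage, Alice draws $r\in(0,1)$ uniformly and tests Bob before the computation of that stage if $r\le p$, after it if $p<r\le 2p$, and not at all otherwise; a failed test terminates the protocol. In a test she draws uniformly $\mu<\nu$ in $\{0,1\}^k$, an address qubit $m$, $x\in\{0,1\}^n$ and $b\in\{0,1\}$, and puts $U_t=\mathrm{SWAP}(0,m)\,Z(x)\,X_0^b\,V\,(H^{\otimes n}\otimes I)$, where $V|a\rangle|\tau\rangle$ is $|a\rangle|\tau\oplus\mu\rangle$ if $a_0=0$ and $|a\rangle|\tau\oplus\nu\rangle$ if $a_0=1$, and $Z(x)$ applies $Z$ to the address qubits $j$ with $x_j=1$. * In round $i$: two copies of $U_t^\dagger U_{f_i}U_t|0\rangle$ are prepared and measured in the computational basis. Bob passes if the two results agree on the first address qubit and are $0$ on all other qubits. * In the final stage: two copies of $U_t^\dagger U'_fU_t|0\rangle|0\rangle$ (with one more ancilla each) are prepared. Bob passes if they pass a controlled swap test and then all address and data qubits except the first address qubits are measured as $0$. **Claim.** Assume that $T>100/\sqrt{s_{\min}}$ if Bob employs the trivial strategy and that $T>200/\sqrt{s_{\min}}$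 if he employs a nontrivial strategy. Then for each $i\in\{1,2\}$, with probability at least $\frac{8}{\pi^2}>0.8$, the protocol is not terminated and $$\begin{cases}\left|\frac{s_i}{s}-1\right|<\frac{2\pi}{100}\sqrt{\frac{s_{\min}}{s}}+\frac{\pi^2}{10^4}\frac{s_{\min}}{s}<0.07, & \text{if } s\ge s_{\min},\\[1ex] \frac{|s_i-s|}{s_{\min}}<\frac{2\pi}{100}\sqrt{\frac{s}{s_{\min}}}+\frac{\pi^2}{10^4}<0.07, & \text{if } s<s_{\min}.\end{cases}$$ -/

import Mathlib

open scoped Kronecker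

noncomputable section

namespace QCount

/-! ### Registers, gates and measurement weights

Qubit registers are indexed by bit strings; bits are elements of `ZMod 2`, so that `+` is XOR.
A state is a vector of amplitudes over the computational basis. -/

/-- Bit strings of length `m`. -/
abbrev Bits (m : ℕ) : Type := Fin m → ZMod 2

/-- The integer represented in binary by the positions `w ∈ M` of a bit string, read in increasing
order of `w` with the most significant bit first. -/
def binVal {m : ℕ} (M : Finset (Fin m)) (c : Bits m) : ℕ :=
  ∑ w ∈ M, (c w).val * 2 ^ (M.filter (fun v => w < v)).card

/-- The gate `|j⟩ ↦ |σ j⟩`. -/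
def permGate {ι : Type} [DecidableEq ι] (σ : ι → ι) : Matrix ι ι ℂ :=
  Matrix.of fun i j => if i = σ j then 1 else 0

/-- The basis vector `|i⟩`. -/
def ket {ι : Type} [DecidableEq ι] (i : ι) : ι → ℂ := Pi.single i 1

/-- The state `|+⟩^{⊗ m}`. -/
def plusKet (m : ℕ) : Bits m → ℂ := fun _ => ((√(2 ^ m : ℝ) : ℝ) : ℂ)⁻¹

/-- The Hadamard gate on one qubit. -/
def hGate : Matrix (ZMod 2) (ZMod 2) ℂ :=
  Matrix.of fun a b => ((√2 : ℝ) : ℂ)⁻¹ * (-1) ^ (a.val * b.val)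

/-- `W = H^{⊗ m}`. -/
def hadamard (m : ℕ) : Matrix (Bits m) (Bits m) ℂ :=
  Matrix.of fun a b => ∏ j, hGate (a j) (b j)

/-- The quantum Fourier transform (modulo `2 ^ #M`) on the qubits in `M`, the other qubits of the
register being left alone. -/
def qft {t : ℕ} (M : Finset (Fin t)) : Matrix (Bits t) (Bits t) ℂ :=
  Matrix.of fun c' c =>
    if ∀ w, w ∉ M → c' w = c w then
      ((√(2 ^ M.card : ℝ) : ℝ) : ℂ)⁻¹ *
        Complex.exp (2 * Real.pi * Complex.I * (binVal M c) * (binVal M c') / 2 ^ M.card)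
    else 0

/-! ### The database and the operators of the two parties -/

/-- Basis of the address and data registers `q_a, q_d`. -/
abbrev AD (n k : ℕ) : Type := Bits n × Bits k

/-- A database with `N = 2 ^ n` transactions `d_x ∈ {0,1}^k`, indexed by their addresses. -/
abbrev Database (n k : ℕ) : Type := Bits n → Bits k

/-- `f(D) = (1/N) ∑_j f(d_j)`. -/
def frac {n k : ℕ} (D : Database n k) (f : Bits k → ZMod 2) : ℝ :=
  1 / 2 ^ n * ∑ x, ((f (D x)).val : ℝ)

/-- The quantum database `O_D |x⟩|τ⟩ = |x⟩|τ ⊕ d_x⟩`. -/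
def oracle {n k : ℕ} (D : Database n k) : Matrix (AD n k) (AD n k) ℂ :=
  permGate fun s => (s.1, s.2 + D s.1)

/-- `X^y ⊗ I_d`. -/
def shiftX {n k : ℕ} (y : Bits n) : Matrix (AD n k) (AD n k) ℂ :=
  permGate fun s => (s.1 + y, s.2)

/-- Alice's operator `U_D(y) = (X^y ⊗ I_d) O_D (X^y ⊗ I_d)`. -/
def UD {n k : ℕ} (D : Database n k) (y : Bits n) : Matrix (AD n k) (AD n k) ℂ :=
  shiftX y * oracle D * shiftX y

/-- Bob's operator `U_f |j⟩|τ⟩ = (-1)^{f(τ)} |j⟩|τ⟩`. -/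
def Uf (n : ℕ) {k : ℕ} (f : Bits k → ZMod 2) : Matrix (AD n k) (AD n k) ℂ :=
  Matrix.diagonal fun s => (-1) ^ (f s.2).val

/-- `Ḡ = G ⊗ I_d` with `G = I - 2 |+⟩^{⊗ n}⟨+|^{⊗ n}`. -/
def Gbar (n k : ℕ) : Matrix (AD n k) (AD n k) ℂ :=
  (1 - (2 : ℂ) • Matrix.vecMulVec (plusKet n) (star (plusKet n))) ⊗ₖ (1 : Matrix (Bits k) (Bits k) ℂ)

/-- One uncontrolled iteration `Ḡ U_D(y) U_g U_D(y)`. -/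
def iter {n k : ℕ} (D : Database n k) (y : Bits n) (g : Bits k → ZMod 2) :
    Matrix (AD n k) (AD n k) ℂ :=
  Gbar n k * UD D y * Uf n g * UD D y

/-! ### Bob's strategies -/

/-- Round `i` belongs to the control qubit `C_w`: the rounds `1, …, 2^{t-1}` belong to `C_0`, the
next `2^{t-2}` rounds to `C_1`, and so on; round `0` belongs to no control qubit. -/
def InBlock {t : ℕ} (w : Fin t) (i : ℕ) : Prop :=
  2 ^ t - 2 ^ (t - w.val) < i ∧ i ≤ 2 ^ t - 2 ^ (t - w.val - 1)

instance {t : ℕ} (w : Fin t) (i : ℕ) : Decidable (InBlock w i) := by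
  unfold InBlock; infer_instance

/-- The effect of `L` successive iterations with the functions `g 0, …, g (L-1)`. -/
def effect {n k : ℕ} (D : Database n k) (y : Bits n) (g : ℕ → Bits k → ZMod 2) :
    ℕ → Matrix (AD n k) (AD n k) ℂ
  | 0 => 1
  | L + 1 => iter D y (g L) * effect D y g L

/-- The effect of the `2^{t-w-1}` iterations that belong to the control qubit `C_w`. -/
def blockEffect {n k t : ℕ} (D : Database n k) (y : Bits n) (fs : ℕ → Bits k → ZMod 2)
    (w : Fin t) : Matrix (AD n k) (AD n k) ℂ :=
  effect D y (fun l => fs (2 ^ t - 2 ^ (t - w.val) + 1 + l)) (2 ^ (t - w.val - 1))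

/-- `f_0, …, f_{T-1}` (`T = 2 ^ t`) is a strategy for computing `f(D)`: the trivial one (`none`),
or one with confusing qubit `C_u` (`some u`). In the second case noise is added to the functions of
`C_0, …, C_u` only, the functions of `C_u` have the effect of the identity, and for `w < u` half of
the `2^{t-w-1}` iterations of `C_w` cancel, so that their effect is that of `2^{t-w-2}` repetitions
of `f`. -/
def IsStrategy {n k t : ℕ} (D : Database n k) (f : Bits k → ZMod 2)
    (fs : ℕ → Bits k → ZMod 2) : Option (Fin t) → Prop
  | none => ∀ i, i < 2 ^ t → fs i = f
  | some u => u.val + 1 < t ∧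
      (∀ w : Fin t, w < u → ∀ y, blockEffect D y fs w = iter D y f ^ 2 ^ (t - w.val - 2)) ∧
      (∀ y, blockEffect D y fs u = 1) ∧
      (∀ w : Fin t, u < w → ∀ i, InBlock w i → fs i = f)

/-- The control qubits to which the final Fourier transform and measurement are applied: all of
them, except the confusing qubit if there is one. -/
def readQubits {t : ℕ} : Option (Fin t) → Finset (Fin t)
  | none => Finset.univ
  | some u => Finset.univ.erase u

/-! ### The computational states -/

/-- Basis of one copy of the registers: address and data `q_a, q_d`, control `q_c`, ancilla
`q_g`. -/
abbrev Copy (n k t : ℕ) : Type := (AD n k × Bits t) × ZMod 2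

/-- Basis of the two copies together. -/
abbrev Joint (n k t : ℕ) : Type := Copy n k t × Copy n k t

/-- Apply `A` on `q_a, q_d`. -/
def onAD {n k : ℕ} (t : ℕ) (A : Matrix (AD n k) (AD n k) ℂ) :
    Matrix (Copy n k t) (Copy n k t) ℂ :=
  Matrix.blockDiagonal fun _ => Matrix.blockDiagonal fun _ => A

/-- Controlled `A` in round `i`: `A` is activated iff round `i` belongs to a control qubit and this
control qubit is in state `|1⟩`. -/
def controlled {n k : ℕ} (t i : ℕ) (A : Matrix (AD n k) (AD n k) ℂ) :
    Matrix (Copy n k t) (Copy n k t) ℂ :=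
  Matrix.blockDiagonal fun _ => Matrix.blockDiagonal fun c : Bits t =>
    if ∃ w, InBlock w i ∧ c w = 1 then A else 1

/-- `U'_f |j⟩|τ⟩|g⟩ = |j⟩|τ⟩|g ⊕ f(τ)⟩` on `q_a, q_d, q_g`. -/
def Uf' (n : ℕ) {k : ℕ} (t : ℕ) (f : Bits k → ZMod 2) : Matrix (Copy n k t) (Copy n k t) ℂ :=
  permGate fun s => (s.1, s.2 + f s.1.1.2)

/-- Fourier transform on the qubits `M` of `q_c`. -/
def fourier (n k : ℕ) {t : ℕ} (M : Finset (Fin t)) : Matrix (Copy n k t) (Copy n k t) ℂ :=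
  ((1 : Matrix (AD n k) (AD n k) ℂ) ⊗ₖ qft M) ⊗ₖ (1 : Matrix (ZMod 2) (ZMod 2) ℂ)

/-- Apply `A` on the first copy. -/
def onFst {n k t : ℕ} (A : Matrix (Copy n k t) (Copy n k t) ℂ) :
    Matrix (Joint n k t) (Joint n k t) ℂ := A ⊗ₖ 1

/-- Apply `A` on the second copy. -/
def onSnd {n k t : ℕ} (A : Matrix (Copy n k t) (Copy n k t) ℂ) :
    Matrix (Joint n k t) (Joint n k t) ℂ := 1 ⊗ₖ A

/-- Bob's initial state `|+⟩^{⊗ t} |+⟩^{⊗ n} |0⟩` of one copy, with the ancilla in `|0⟩`. -/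
def initCopy (n k t : ℕ) : Copy n k t → ℂ := fun s =>
  plusKet n s.1.1.1 * ket (0 : Bits k) s.1.1.2 * plusKet t s.1.2 * ket (0 : ZMod 2) s.2

/-- Procedure GroverIteration(`i`) on the two copies. -/
def groverRound {n k : ℕ} (t : ℕ) (D : Database n k) (y : Bits n) (g : Bits k → ZMod 2) (i : ℕ) :
    Matrix (Joint n k t) (Joint n k t) ℂ :=
  let A := controlled t i (Uf n g) * onAD t (UD D y)
  let B := controlled t i (Gbar n k) * onAD t (UD D y)
  onSnd B * onFst B * onSnd A * onFst A

/-- The state of the two copies after the rounds `0, …, i-1`. -/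
def stateAfter {n k : ℕ} (t : ℕ) (D : Database n k) (y : Bits n) (fs : ℕ → Bits k → ZMod 2) :
    ℕ → Joint n k t → ℂ
  | 0 => fun s => initCopy n k t s.1 * initCopy n k t s.2
  | i + 1 => (groverRound t D y (fs i) i).mulVec (stateAfter t D y fs i)

/-- The state right before the final measurements: after the `T = 2 ^ t` rounds, Alice applies
`U_D(y)` and Bob `U'_f` on each copy, Alice applies `U_D(y)` on each copy, and Bob performs the
Fourier transform on the control qubits `M` of each copy. -/
def finalState {n k t : ℕ} (D : Database n k) (y : Bits n) (f : Bits k → ZMod 2)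
    (fs : ℕ → Bits k → ZMod 2) (M : Finset (Fin t)) : Joint n k t → ℂ :=
  let A := Uf' n t f * onAD t (UD D y)
  let U : Matrix (Copy n k t) (Copy n k t) ℂ := onAD t (UD D y)
  let F := fourier n k M
  (onSnd F * onFst F * onSnd U * onFst U * onSnd A * onFst A).mulVec (stateAfter t D y fs (2 ^ t))

/-- Bob's estimate `cos²(θ π / 2^{#M})` from the outcome `θ ∈ {0, …, 2^{#M} - 1}` of the measurement
of the control qubits `M`. The iteration `Ḡ U_D U_f U_D` with `G = I - 2|+⟩⟨+|` has the eigenvalues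
`-exp(± 2 i φ)`, `sin² φ = f(D)`, on the relevant plane, so the estimate is the same function of `θ`
for both outcomes of the measurement of the ancilla. -/
def estimate {n k t : ℕ} (M : Finset (Fin t)) (s : Copy n k t) : ℝ :=
  Real.cos (binVal M s.1.2 * Real.pi / 2 ^ M.card) ^ 2

/-! ### Alice's tests -/

/-- The random data `(μ < ν), m, x, b` of a test. (The random string on the control register of a
test state is not touched by any operation and is left out.) -/
abbrev TestData (n k : ℕ) : Type :=
  {q : Bits k × Bits k // binVal Finset.univ q.1 < binVal Finset.univ q.2} ×
    Fin n × Bits n × ZMod 2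

/-- `U_t = SWAP(0,m) Z(x) X_0^b V(μ,ν) (W ⊗ I_d)`. -/
def Ut {n k : ℕ} [NeZero n] (d : TestData n k) : Matrix (AD n k) (AD n k) ℂ :=
  let swapGate : Matrix (AD n k) (AD n k) ℂ := permGate fun s => (s.1 ∘ Equiv.swap 0 d.2.1, s.2)
  let zGate : Matrix (AD n k) (AD n k) ℂ :=
    Matrix.diagonal fun s => ∏ j, (-1) ^ ((d.2.2.1 j).val * (s.1 j).val)
  let xGate : Matrix (AD n k) (AD n k) ℂ := permGate fun s => (s.1 + Pi.single 0 d.2.2.2, s.2)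
  let V : Matrix (AD n k) (AD n k) ℂ :=
    permGate fun s => (s.1, s.2 + if s.1 0 = 0 then d.1.1.1 else d.1.1.2)
  swapGate * zGate * xGate * V * (hadamard n ⊗ₖ (1 : Matrix (Bits k) (Bits k) ℂ))

open Classical in
/-- Probability that honest Bob passes TestBob1 in a round with function `g`: the state `Φ` is
prepared twice, both are measured, and the outcomes `v, w` must agree on the first address qubit and
vanish on all other qubits. -/
def passTest1 (n : ℕ) {k : ℕ} [NeZero n] (g : Bits k → ZMod 2) : ℝ :=
  (∑ d : TestData n k,
    let Φ := ((Ut d).conjTranspose * Uf n g * Ut d).mulVec (ket (0, 0))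
    ∑ v : AD n k, ∑ w : AD n k,
      if v.1 0 = w.1 0 ∧ (∀ j, j ≠ 0 → v.1 j = 0 ∧ w.1 j = 0) ∧ v.2 = 0 ∧ w.2 = 0
      then ‖Φ v‖ ^ 2 * ‖Φ w‖ ^ 2 else 0) / Fintype.card (TestData n k)

open Classical in
/-- Probability that honest Bob passes TestBob2: two copies of `Φ` (on `q_a, q_d, q_g`) go through a
controlled swap test, where the outcome of the control qubit must be `0`, and all address and data
qubits except the first address qubits must be measured as `0`. -/
def passTest2 (n : ℕ) {k : ℕ} [NeZero n] (f : Bits k → ZMod 2) : ℝ :=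
  (∑ d : TestData n k,
    let S := AD n k × ZMod 2
    let U : Matrix S S ℂ := Ut d ⊗ₖ (1 : Matrix (ZMod 2) (ZMod 2) ℂ)
    let U' : Matrix S S ℂ := permGate fun s => (s.1, s.2 + f s.1.2)
    let Φ : S → ℂ := (U.conjTranspose * U' * U).mulVec (ket ((0, 0), 0))
    let cswap : Matrix (ZMod 2 × S × S) (ZMod 2 × S × S) ℂ :=
      permGate fun s => if s.1 = 1 then (s.1, s.2.2, s.2.1) else s
    let start : ZMod 2 × S × S → ℂ := fun s => ((√2 : ℝ) : ℂ)⁻¹ * Φ s.2.1 * Φ s.2.2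
    let Ψ := ((hGate ⊗ₖ (1 : Matrix (S × S) (S × S) ℂ)) * cswap).mulVec start
    ∑ v : S, ∑ w : S,
      if (∀ j, j ≠ 0 → v.1.1 j = 0 ∧ w.1.1 j = 0) ∧ v.1.2 = 0 ∧ w.1.2 = 0
      then ‖Ψ (0, v, w)‖ ^ 2 else 0) / Fintype.card (TestData n k)

/-- Probability that a stage of the protocol is not terminated: Alice draws `r ∈ (0,1)` uniformly;
if `r ≤ p` she tests before the computational round, if `p < r ≤ 2p` after it (each test is passed
with probability `q`), otherwise not at all. -/
def survive (p q : ℝ) : ℝ :=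
  ∫ r in (0 : ℝ)..1, if r ≤ p then q else if r ≤ 2 * p then q else 1

/-! ### The protocol with honest parties -/

open Classical in
/-- Probability that the protocol run by honest parties is not terminated by a test and that its
output `(s_1, s_2)` (here `s 0` and `s 1`) satisfies `E`. Alice's `y` is uniform; the tests act on
fresh registers and do not touch the computational states; the outputs are functions of the results
of measuring the final state in the computational basis. -/
def protocolProb {n k t : ℕ} [NeZero n] (p : ℝ) (D : Database n k) (f : Bits k → ZMod 2)
    (fs : ℕ → Bits k → ZMod 2) (conf : Option (Fin t)) (E : (Fin 2 → ℝ) → Prop) : ℝ :=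
  1 / 2 ^ n * ∑ y : Bits n,
    (∏ i ∈ Finset.range (2 ^ t), survive p (passTest1 n (fs i))) * survive p (passTest2 n f) *
      ∑ s : Joint n k t,
        if E ![estimate (readQubits conf) s.1, estimate (readQubits conf) s.2]
        then ‖finalState D y f fs (readQubits conf) s‖ ^ 2 else 0

end QCount

end

open QCount

/-! The random gates of a test, apart from the Hadamard gates, turn a phase that depends on the data
string into a phase that depends on the data string and the first address qubit. So honest Bob
returns a state in which only the first address qubit (and, in the final stage, the ancilla) can
differ from `0`. For `U_f` it is a basis state, and a swap test of two equal states always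
succeeds; hence all tests are passed with certainty.

Since the confusing qubit has no effect on the address register, a strategy makes the control state
`|c⟩` apply the power `Q_f(y)^m`, where `m` is the integer that the other control qubits spell.
Thus each copy runs phase estimation of `Q_f(y)`, on a superposition of two eigenvectors with the
eigenvalues `-exp (± 2 i φ)`, `sin² φ = s`, in which both have the same weight. With probability at
least `8 / π²` the outcome `θ` is one of the two next to the eigenphase, and then
`|cos² (θ π / T') - s| ≤ 2 √s (π / T') + (π / T')²`, where `π / T' < (π / 100) √s_min`. -/

namespace QCount

open scoped Real

/-! ### Phase estimation -/

theorem sq_one_sub_sq_le_cos_sq_mul_of_le {u : ℝ} (h0 : 0 ≤ u) (hu : u ≤ 3 / 5) :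
    (1 - u ^ 2) ^ 2 ≤ Real.cos (π * u / 2) ^ 2 * (1 + u ^ 2) := by
  have hv : u ^ 2 ≤ 9 / 25 := by nlinarith
  have hv0 : 0 ≤ u ^ 2 := sq_nonneg u
  have hpi : π ^ 2 ≤ 9.9225 := by nlinarith [Real.pi_gt_d2, Real.pi_lt_d2]
  -- `1.2404` is an upper bound of `π ^ 2 / 8`
  have hcos : 1 - 1.2404 * u ^ 2 ≤ Real.cos (π * u / 2) := by
    refine le_trans ?_ Real.one_sub_sq_div_two_le_cos
    nlinarith
  have hcos_sq : (1 - 1.2404 * u ^ 2) ^ 2 ≤ Real.cos (π * u / 2) ^ 2 :=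
    pow_le_pow_left₀ (by nlinarith) hcos 2
  have hpoly : (1 - u ^ 2) ^ 2 ≤ (1 - 1.2404 * u ^ 2) ^ 2 * (1 + u ^ 2) := by
    generalize u ^ 2 = v at hv hv0
    have : 0 ≤ v * (0.5192 - 1.9422 * v + 1.5385 * v ^ 2) := by
      refine mul_nonneg hv0 ?_
      nlinarith
    nlinarith [pow_nonneg hv0 3, pow_nonneg hv0 2]
  exact hpoly.trans (by gcongr)

theorem sq_one_sub_sq_le_sin_sq_mul_of_le {z : ℝ} (h0 : 0 ≤ z) (hz : z ≤ 2 / 5) :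
    (1 - (1 - z) ^ 2) ^ 2 ≤ Real.sin (π * z / 2) ^ 2 * (1 + (1 - z) ^ 2) := by
  rcases h0.eq_or_lt with rfl | hz0
  · norm_num
  have hpi := Real.pi_gt_d2
  have hx : π * z / 2 ≤ 0.63 := by nlinarith [Real.pi_lt_d2]
  have hx0 : 0 < π * z / 2 := by positivity
  have hsin : 1.45 * z ≤ Real.sin (π * z / 2) := by
    refine le_trans ?_ (Real.sin_gt_sub_cube hx0).le
    have : 0 ≤ π * z / 2 * (0.4 / 6 - (π * z / 2) ^ 2 / 6) := mul_nonneg hx0.le (by nlinarith)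
    nlinarith
  have hsin_sq : (1.45 * z) ^ 2 ≤ Real.sin (π * z / 2) ^ 2 :=
    pow_le_pow_left₀ (by positivity) hsin 2
  have hpoly : (1 - (1 - z) ^ 2) ^ 2 ≤ (1.45 * z) ^ 2 * (1 + (1 - z) ^ 2) := by
    have : (2 - z) ^ 2 ≤ 2.1 * (1 + (1 - z) ^ 2) := by nlinarith
    have := mul_le_mul_of_nonneg_left this (sq_nonneg z)
    nlinarith [mul_nonneg (sq_nonneg z) (add_nonneg zero_le_one (sq_nonneg (1 - z)))]
  exact hpoly.trans (by gcongr)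

theorem sq_one_sub_sq_le_cos_sq_mul {u : ℝ} (h0 : 0 ≤ u) (h1 : u ≤ 1) :
    (1 - u ^ 2) ^ 2 ≤ Real.cos (π * u / 2) ^ 2 * (1 + u ^ 2) := by
  rcases le_total u (3 / 5) with hu | hu
  · exact sq_one_sub_sq_le_cos_sq_mul_of_le h0 hu
  · have hcos : Real.cos (π * u / 2) = Real.sin (π * (1 - u) / 2) := by
      rw [← Real.sin_pi_div_two_sub]
      ring_nf
    rw [hcos]
    simpa only [sub_sub_cancel] using
      sq_one_sub_sq_le_sin_sq_mul_of_le (z := 1 - u) (by linarith) (by linarith)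

theorem eight_le_sin_sq_div_sq_add {e : ℝ} (h0 : 0 < e) (h1 : e < 1) :
    8 ≤ Real.sin (π * e) ^ 2 / e ^ 2 + Real.sin (π * (1 - e)) ^ 2 / (1 - e) ^ 2 := by
  have hsin : Real.sin (π * (1 - e)) = Real.sin (π * e) := by
    rw [← Real.sin_pi_sub]
    ring_nf
  have hcos : Real.cos (π * |2 * e - 1| / 2) = Real.sin (π * e) := by
    rw [← Real.cos_pi_div_two_sub]
    rcases abs_choice (2 * e - 1) with h | h <;> rw [h]
    · rw [← Real.cos_neg]
      ring_nf
    · ring_nf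
  -- with `u = |2 * e - 1|`, `e * (1 - e) = (1 - u ^ 2) / 4` and `e² + (1 - e)² = (1 + u ^ 2) / 2`
  have key := sq_one_sub_sq_le_cos_sq_mul (abs_nonneg (2 * e - 1))
    (abs_le.2 ⟨by linarith, by linarith⟩)
  rw [hcos, sq_abs] at key
  have : 0 < 1 - e := sub_pos.2 h1
  rw [hsin, div_add_div _ _ (by positivity) (by positivity), le_div_iff₀ (by positivity)]
  nlinarith

/-- The amplitude with which phase estimation with `T` repetitions yields an outcome whose phase
differs by `α` from the true one. -/
noncomputable def phaseAmp (T : ℕ) (α : ℝ) : ℂ :=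
  (T : ℂ)⁻¹ * ∑ m ∈ Finset.range T, Complex.exp (Complex.I * α) ^ m

theorem phaseAmp_add_int_mul_two_pi (T : ℕ) (α : ℝ) (j : ℤ) :
    phaseAmp T (α + j * (2 * π)) = phaseAmp T α := by
  have : Complex.I * ((α + j * (2 * π) : ℝ) : ℂ) =
      Complex.I * α + j * (2 * π * Complex.I) := by
    push_cast
    ring
  rw [phaseAmp, this, Complex.exp_add, Complex.exp_int_mul_two_pi_mul_I, mul_one, phaseAmp]

theorem phaseAmp_zero {T : ℕ} (hT : T ≠ 0) : phaseAmp T 0 = 1 := by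
  have : (T : ℂ) ≠ 0 := by exact_mod_cast hT
  simp [phaseAmp, this]

theorem phaseAmp_one (α : ℝ) : phaseAmp 1 α = 1 := by
  simp [phaseAmp]

theorem norm_phaseAmp_mul_abs_sin (T : ℕ) (α : ℝ) :
    ‖phaseAmp T α‖ * |Real.sin (α / 2)| = |Real.sin (T * α / 2)| / T := by
  have hgeom := congrArg norm (geom_sum_mul (Complex.exp (Complex.I * α)) T)
  have hpow : Complex.exp (Complex.I * α) ^ T = Complex.exp (Complex.I * ((T * α : ℝ) : ℂ)) := by
    rw [← Complex.exp_nat_mul]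
    congr 1
    push_cast
    ring
  rw [norm_mul, hpow, Complex.norm_exp_I_mul_ofReal_sub_one,
    Complex.norm_exp_I_mul_ofReal_sub_one, norm_mul, norm_mul, Real.norm_two, Real.norm_eq_abs,
    Real.norm_eq_abs] at hgeom
  rw [phaseAmp, norm_mul, norm_inv, Complex.norm_natCast]
  linear_combination (T : ℝ)⁻¹ / 2 * hgeom

theorem sin_sq_div_le_norm_phaseAmp_sq {T : ℕ} (hT : 0 < T) (e : ℝ) :
    Real.sin (π * e) ^ 2 / (π ^ 2 * e ^ 2) ≤ ‖phaseAmp T (2 * π * e / T)‖ ^ 2 := by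
  have hT' : (0 : ℝ) < T := by exact_mod_cast hT
  have hsin : |Real.sin (π * e)| / T ≤ ‖phaseAmp T (2 * π * e / T)‖ * (|π * e| / T) :=
    calc |Real.sin (π * e)| / T = ‖phaseAmp T (2 * π * e / T)‖ * |Real.sin (π * e / T)| := by
          have := norm_phaseAmp_mul_abs_sin T (2 * π * e / T)
          field_simp at this ⊢
          exact this.symm
      _ ≤ ‖phaseAmp T (2 * π * e / T)‖ * |π * e / T| :=
        mul_le_mul_of_nonneg_left Real.abs_sin_le_abs (norm_nonneg _)
      _ = ‖phaseAmp T (2 * π * e / T)‖ * (|π * e| / T) := by rw [abs_div, abs_of_pos hT']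
  rw [mul_div_assoc', div_le_div_iff_of_pos_right hT'] at hsin
  have hsq := pow_le_pow_left₀ (abs_nonneg _) hsin 2
  rw [sq_abs, mul_pow, sq_abs, mul_pow] at hsq
  exact div_le_of_le_mul₀ (by positivity) (by positivity) hsq

theorem eight_div_pi_sq_le_norm_phaseAmp_sq_add {T : ℕ} (hT : 0 < T) {e : ℝ} (he0 : 0 < e)
    (he1 : e < 1) : 8 / π ^ 2 ≤
      ‖phaseAmp T (2 * π * (-e) / T)‖ ^ 2 + ‖phaseAmp T (2 * π * (1 - e) / T)‖ ^ 2 :=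
  calc 8 / π ^ 2
      ≤ (Real.sin (π * e) ^ 2 / e ^ 2 + Real.sin (π * (1 - e)) ^ 2 / (1 - e) ^ 2) / π ^ 2 := by
        gcongr
        exact eight_le_sin_sq_div_sq_add he0 he1
    _ = Real.sin (π * -e) ^ 2 / (π ^ 2 * (-e) ^ 2) +
          Real.sin (π * (1 - e)) ^ 2 / (π ^ 2 * (1 - e) ^ 2) := by
        rw [mul_neg, Real.sin_neg, neg_sq, neg_sq, add_div, div_div, div_div, mul_comm (π ^ 2),
          mul_comm (π ^ 2)]
    _ ≤ ‖phaseAmp T (2 * π * (-e) / T)‖ ^ 2 + ‖phaseAmp T (2 * π * (1 - e) / T)‖ ^ 2 :=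
        add_le_add (sin_sq_div_le_norm_phaseAmp_sq hT _) (sin_sq_div_le_norm_phaseAmp_sq hT _)

theorem sum_range_pow_mul_conj_pow {T : ℕ} {ζ : ℂ} (hζ : IsPrimitiveRoot ζ T) {m l : ℕ}
    (hm : m < T) (hl : l < T) :
    ∑ θ ∈ Finset.range T, ζ ^ (m * θ) * starRingEnd ℂ (ζ ^ (l * θ)) =
      if m = l then (T : ℂ) else 0 := by
  have hT : T ≠ 0 := by omega
  have hnorm : ‖ζ‖ = 1 := hζ.norm'_eq_one hT
  have hζ0 : ζ ≠ 0 := hζ.ne_zero hT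
  have hterm (θ : ℕ) : ζ ^ (m * θ) * starRingEnd ℂ (ζ ^ (l * θ)) = (ζ ^ m * (ζ ^ l)⁻¹) ^ θ := by
    rw [map_pow, ← Complex.inv_eq_conj hnorm, mul_pow, inv_pow, inv_pow, pow_mul, pow_mul]
  simp_rw [hterm]
  split_ifs with h
  · subst h
    simp [hζ0]
  · have hne : ζ ^ m * (ζ ^ l)⁻¹ ≠ 1 := fun h1 =>
      h (hζ.pow_inj hm hl ((mul_inv_eq_one₀ (pow_ne_zero _ hζ0)).1 h1))
    have hroot : (ζ ^ m * (ζ ^ l)⁻¹) ^ T = 1 := by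
      rw [mul_pow, inv_pow, pow_right_comm, pow_right_comm ζ l, hζ.pow_eq_one]
      simp
    have hgeom := geom_sum_mul (ζ ^ m * (ζ ^ l)⁻¹) T
    rw [hroot, sub_self] at hgeom
    exact (mul_eq_zero.1 hgeom).resolve_right (sub_ne_zero.2 hne)

theorem sum_norm_sq_sum_mul_pow {T : ℕ} {ζ : ℂ} (hζ : IsPrimitiveRoot ζ T) (a : ℕ → ℂ) :
    ∑ θ ∈ Finset.range T, ‖∑ m ∈ Finset.range T, a m * ζ ^ (m * θ)‖ ^ 2 =
      T * ∑ m ∈ Finset.range T, ‖a m‖ ^ 2 := by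
  apply Complex.ofReal_injective
  push_cast
  calc ∑ θ ∈ Finset.range T, (‖∑ m ∈ Finset.range T, a m * ζ ^ (m * θ)‖ : ℂ) ^ 2
      = ∑ θ ∈ Finset.range T, ∑ m ∈ Finset.range T, ∑ l ∈ Finset.range T,
          a m * starRingEnd ℂ (a l) * (ζ ^ (m * θ) * starRingEnd ℂ (ζ ^ (l * θ))) := by
        refine Finset.sum_congr rfl fun θ _ => ?_
        rw [← Complex.mul_conj', map_sum, Finset.sum_mul_sum]
        simp only [map_mul, mul_mul_mul_comm]
    _ = ∑ m ∈ Finset.range T, ∑ l ∈ Finset.range T, a m * starRingEnd ℂ (a l) *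
          ∑ θ ∈ Finset.range T, ζ ^ (m * θ) * starRingEnd ℂ (ζ ^ (l * θ)) := by
        rw [Finset.sum_comm]
        refine Finset.sum_congr rfl fun m _ => ?_
        rw [Finset.sum_comm]
        simp only [Finset.mul_sum]
    _ = ∑ m ∈ Finset.range T, T * (‖a m‖ : ℂ) ^ 2 := by
        refine Finset.sum_congr rfl fun m hm => ?_
        rw [Finset.sum_congr rfl fun l hl => by
          rw [sum_range_pow_mul_conj_pow hζ (Finset.mem_range.1 hm) (Finset.mem_range.1 hl),
            mul_ite, mul_zero], Finset.sum_ite_eq, if_pos hm, Complex.mul_conj', mul_comm]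
    _ = T * ∑ m ∈ Finset.range T, (‖a m‖ : ℂ) ^ 2 := (Finset.mul_sum ..).symm

theorem sum_norm_phaseAmp_sq {T : ℕ} (hT : 0 < T) (β : ℝ) :
    ∑ θ ∈ Finset.range T, ‖phaseAmp T (2 * π * θ / T + β)‖ ^ 2 = 1 := by
  have hT' : (T : ℝ) ≠ 0 := by exact_mod_cast hT.ne'
  have hphase (θ : ℕ) : phaseAmp T (2 * π * θ / T + β) =
      (T : ℂ)⁻¹ * ∑ m ∈ Finset.range T, Complex.exp (Complex.I * β) ^ m *
        Complex.exp (2 * π * Complex.I / T) ^ (m * θ) := by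
    rw [phaseAmp]
    congr 1
    refine Finset.sum_congr rfl fun m _ => ?_
    rw [← Complex.exp_nat_mul, ← Complex.exp_nat_mul, ← Complex.exp_nat_mul, ← Complex.exp_add]
    congr 1
    push_cast
    ring
  simp_rw [hphase, norm_mul, mul_pow]
  rw [← Finset.mul_sum, sum_norm_sq_sum_mul_pow (Complex.isPrimitiveRoot_exp T hT.ne')]
  simp only [norm_inv, Complex.norm_natCast, norm_pow, Complex.norm_exp_I_mul_ofReal, one_pow,
    Finset.sum_const, Finset.card_range, nsmul_eq_mul, mul_one]
  field_simp

theorem sum_range_add_of_periodic {M : Type*} [AddCommMonoid M] [IsRightCancelAdd M] {T : ℕ}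
    {F : ℤ → M} (hF : Function.Periodic F T) (a : ℤ) :
    ∑ θ ∈ Finset.range T, F (a + θ) = ∑ θ ∈ Finset.range T, F θ := by
  have shift (b : ℤ) :
      ∑ θ ∈ Finset.range T, F (b + 1 + θ) = ∑ θ ∈ Finset.range T, F (b + θ) := by
    have h := (Finset.sum_range_succ' (fun θ : ℕ => F (b + θ)) T).symm.trans
      (Finset.sum_range_succ (fun θ : ℕ => F (b + θ)) T)
    rw [hF b, Nat.cast_zero, add_zero] at h
    simpa only [Nat.cast_add, Nat.cast_one, add_assoc, add_comm (1 : ℤ)] using add_right_cancel h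
  induction a using Int.induction_on with
  | zero => simp only [zero_add]
  | succ b ih => exact (shift b).trans ih
  | pred b ih => rw [← ih, ← shift, sub_add_cancel]

theorem le_sum_range_of_periodic {M : Type*} [AddCommMonoid M] [PartialOrder M]
    [IsOrderedCancelAddMonoid M] {T : ℕ} (hT : 0 < T) {F : ℤ → M} (hF : Function.Periodic F T)
    (h0 : ∀ a, 0 ≤ F a) (a : ℤ) : F a ≤ ∑ θ ∈ Finset.range T, F θ := by
  rw [← sum_range_add_of_periodic hF a]
  simpa using Finset.single_le_sum (f := fun θ : ℕ => F (a + θ)) (fun θ _ => h0 _)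
    (Finset.mem_range.2 hT)

theorem add_le_sum_range_of_periodic {M : Type*} [AddCommMonoid M] [PartialOrder M]
    [IsOrderedCancelAddMonoid M] {T : ℕ} (hT : 1 < T) {F : ℤ → M} (hF : Function.Periodic F T)
    (h0 : ∀ a, 0 ≤ F a) (a : ℤ) :
    F a + F (a + 1) ≤ ∑ θ ∈ Finset.range T, F θ := by
  rw [← sum_range_add_of_periodic hF a]
  simpa [Finset.sum_range_succ] using Finset.sum_le_sum_of_subset_of_nonneg
    (f := fun θ : ℕ => F (a + θ)) (Finset.range_mono hT) (fun θ _ _ => h0 _)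

/-- The phase `α` is within `δ` of a multiple of `2π`. -/
def NearZeroPhase (δ α : ℝ) : Prop :=
  ∃ j : ℤ, |α - j * (2 * π)| ≤ δ

theorem nearZeroPhase_add_int_mul_two_pi {δ α : ℝ} (j : ℤ) :
    NearZeroPhase δ (α + j * (2 * π)) ↔ NearZeroPhase δ α := by
  refine ⟨fun ⟨i, hi⟩ => ⟨i - j, ?_⟩, fun ⟨i, hi⟩ => ⟨i + j, ?_⟩⟩
  · convert hi using 2
    push_cast
    ring
  · convert hi using 2
    push_cast
    ring

open Classical in
/-- The probability `‖phaseAmp T α‖ ^ 2` of a phase distance `α`, counted only if the outcome is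
one of those next to the true phase. -/
noncomputable def nearPhaseProb (T : ℕ) (α : ℝ) : ℝ :=
  if NearZeroPhase (2 * π / T) α then ‖phaseAmp T α‖ ^ 2 else 0

theorem nearPhaseProb_nonneg (T : ℕ) (α : ℝ) : 0 ≤ nearPhaseProb T α := by
  rw [nearPhaseProb]
  positivity

theorem nearPhaseProb_add_int_mul_two_pi (T : ℕ) (α : ℝ) (j : ℤ) :
    nearPhaseProb T (α + j * (2 * π)) = nearPhaseProb T α := by
  classical
  rw [nearPhaseProb, nearPhaseProb, phaseAmp_add_int_mul_two_pi]
  exact if_congr (nearZeroPhase_add_int_mul_two_pi j) rfl rfl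

theorem nearPhaseProb_two_pi_mul_div {T : ℕ} {e : ℝ} (he : |e| ≤ 1) :
    nearPhaseProb T (2 * π * e / T) = ‖phaseAmp T (2 * π * e / T)‖ ^ 2 := by
  refine if_pos ⟨0, ?_⟩
  rw [Int.cast_zero, zero_mul, sub_zero, abs_div, abs_mul, abs_of_pos Real.two_pi_pos, Nat.abs_cast]
  exact div_le_div_of_nonneg_right (mul_le_of_le_one_right Real.two_pi_pos.le he) T.cast_nonneg

theorem nearPhaseProb_le_ite {T : ℕ} {α : ℝ} {Q : Prop} [Decidable Q]
    (h : NearZeroPhase (2 * π / T) α → Q) :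
    nearPhaseProb T α ≤ if Q then ‖phaseAmp T α‖ ^ 2 else 0 := by
  rw [nearPhaseProb]
  split_ifs with hα hQ
  · exact le_rfl
  · exact absurd (h hα) hQ
  · positivity
  · exact le_rfl

theorem eight_div_pi_sq_le_one : 8 / π ^ 2 ≤ 1 := by
  rw [div_le_one (by positivity)]
  nlinarith [Real.pi_gt_three]

/-- The outcomes `⌊x⌋` and `⌊x⌋ + 1` suffice; if `x` is an integer or `T = 1`, they are not two
different outcomes next to `x`, but then `⌊x⌋` alone is certain. -/
theorem eight_div_pi_sq_le_sum_nearPhaseProb_sub {T : ℕ} (hT : 0 < T) (x : ℝ) :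
    8 / π ^ 2 ≤ ∑ θ ∈ Finset.range T, nearPhaseProb T (2 * π * (θ - x) / T) := by
  have hT' : (T : ℝ) ≠ 0 := by exact_mod_cast hT.ne'
  let F : ℤ → ℝ := fun a => nearPhaseProb T (2 * π * (a - x) / T)
  have hF : Function.Periodic F T := fun a => by
    refine (congrArg (nearPhaseProb T) ?_).trans (nearPhaseProb_add_int_mul_two_pi T _ 1)
    push_cast
    field_simp
    ring
  have hF0 (a : ℤ) : 0 ≤ F a := nearPhaseProb_nonneg _ _
  have hFeq {a : ℤ} (ha : |a - x| ≤ 1) : F a = ‖phaseAmp T (2 * π * (a - x) / T)‖ ^ 2 :=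
    nearPhaseProb_two_pi_mul_div ha
  have hfract : (⌊x⌋ : ℝ) - x = -Int.fract x := by rw [Int.fract]; ring
  have hfract_lt := Int.fract_lt_one x
  have hfloor : F ⌊x⌋ = ‖phaseAmp T (2 * π * (-Int.fract x) / T)‖ ^ 2 := by
    rw [hFeq, hfract]
    rw [hfract, abs_neg, Int.abs_fract]
    exact hfract_lt.le
  have hsum : ∑ θ ∈ Finset.range T, F θ =
      ∑ θ ∈ Finset.range T, nearPhaseProb T (2 * π * (θ - x) / T) := by
    simp only [F, Int.cast_natCast]
  rw [← hsum]
  by_cases hone : F ⌊x⌋ = 1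
  · exact eight_div_pi_sq_le_one.trans (hone.symm.le.trans (le_sum_range_of_periodic hT hF hF0 _))
  have hfract_pos : 0 < Int.fract x := (Int.fract_nonneg x).lt_of_ne' fun h => hone <| by
    rw [hfloor, h]
    simp [phaseAmp_zero hT.ne']
  have hT1 : 1 < T := lt_of_le_of_ne hT fun h => hone <| by
    rw [hfloor, ← h]
    simp [phaseAmp_one]
  have hceil : F (⌊x⌋ + 1) = ‖phaseAmp T (2 * π * (1 - Int.fract x) / T)‖ ^ 2 := by
    have h : ((⌊x⌋ + 1 : ℤ) : ℝ) - x = 1 - Int.fract x := by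
      push_cast
      linear_combination hfract
    rw [hFeq, h]
    rw [h, abs_le]
    constructor <;> linarith
  calc 8 / π ^ 2 ≤ F ⌊x⌋ + F (⌊x⌋ + 1) := by
        rw [hfloor, hceil]
        exact eight_div_pi_sq_le_norm_phaseAmp_sq_add hT hfract_pos hfract_lt
    _ ≤ ∑ θ ∈ Finset.range T, F θ := add_le_sum_range_of_periodic hT1 hF hF0 _

theorem eight_div_pi_sq_le_sum_nearPhaseProb {T : ℕ} (hT : 0 < T) (β : ℝ) :
    8 / π ^ 2 ≤ ∑ θ ∈ Finset.range T, nearPhaseProb T (2 * π * θ / T + β) := by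
  have hT' : (T : ℝ) ≠ 0 := by exact_mod_cast hT.ne'
  refine (eight_div_pi_sq_le_sum_nearPhaseProb_sub hT (-(β * T / (2 * π)))).trans_eq ?_
  refine Finset.sum_congr rfl fun θ _ => congrArg _ ?_
  field_simp
  ring

/-! ### The error of the estimate -/

theorem sin_sq_sub_sin_sq (x y : ℝ) :
    Real.sin x ^ 2 - Real.sin y ^ 2 = Real.sin (x + y) * Real.sin (x - y) := by
  rw [Real.sin_add, Real.sin_sub]
  linear_combination Real.sin y ^ 2 * Real.sin_sq_add_cos_sq x -
    Real.sin x ^ 2 * Real.sin_sq_add_cos_sq y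

theorem abs_sin_sub_two_mul_le (x y : ℝ) :
    |Real.sin (x - 2 * y)| ≤ |x| + 2 * |Real.sin y| := by
  rw [Real.sin_sub, Real.sin_two_mul]
  refine (abs_sub _ _).trans (add_le_add ?_ ?_)
  · rw [abs_mul]
    exact (mul_le_of_le_one_right (abs_nonneg _) (Real.abs_cos_le_one _)).trans
      Real.abs_sin_le_abs
  · rw [mul_comm, abs_mul, abs_mul, abs_mul, abs_two]
    exact (mul_le_of_le_one_right (by positivity) (Real.abs_cos_le_one x)).trans
      (mul_le_of_le_one_right (by positivity) (Real.abs_cos_le_one y))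

theorem abs_cos_sq_sub_sin_sq_le {a ψ η : ℝ}
    (h : NearZeroPhase (2 * η) (2 * a + (π + 2 * ψ))) :
    |Real.cos a ^ 2 - Real.sin ψ ^ 2| ≤ 2 * |Real.sin ψ| * η + η ^ 2 := by
  obtain ⟨j, hj⟩ := h
  obtain ⟨e, he⟩ : ∃ e, e = a + π / 2 + ψ - j * π := ⟨_, rfl⟩
  have heη : |e| ≤ η := by
    have h2e : 2 * a + (π + 2 * ψ) - j * (2 * π) = 2 * e := by rw [he]; ring
    rw [h2e, abs_mul, abs_two] at hj
    linarith
  have hcos : Real.cos a ^ 2 = Real.sin (e - ψ) ^ 2 := by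
    have h2 : 2 * (e - ψ) = 2 * a + π - j * (2 * π) := by rw [he]; ring
    rw [Real.cos_sq, Real.sin_sq_eq_half_sub, h2, Real.cos_sub_int_mul_two_pi, Real.cos_add_pi]
    ring
  calc |Real.cos a ^ 2 - Real.sin ψ ^ 2|
      = |Real.sin e| * |Real.sin (e - 2 * ψ)| := by
        rw [hcos, sin_sq_sub_sin_sq, abs_mul, sub_add_cancel, sub_sub, ← two_mul]
    _ ≤ η * (η + 2 * |Real.sin ψ|) := by
        gcongr
        · exact (abs_nonneg e).trans heη
        · exact Real.abs_sin_le_abs.trans heη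
        · exact (abs_sin_sub_two_mul_le e ψ).trans (by gcongr)
    _ = 2 * |Real.sin ψ| * η + η ^ 2 := by ring

section ErrorBounds

variable {s smin η c v : ℝ}

theorem abs_sub_lt_of_abs_sub_le (hsmin : 0 < smin) (hη0 : 0 ≤ η) (hη : η < c * √smin)
    (hv : |v - s| ≤ 2 * √s * η + η ^ 2) :
    |v - s| < 2 * c * (√s * √smin) + c ^ 2 * smin := by
  have hη_sq : η ^ 2 < (c * √smin) ^ 2 := pow_lt_pow_left₀ hη hη0 two_ne_zero
  rw [mul_pow, Real.sq_sqrt hsmin.le] at hη_sq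
  nlinarith [mul_le_mul_of_nonneg_left hη.le (Real.sqrt_nonneg s)]

theorem abs_div_sub_one_lt (hsmin : 0 < smin) (hs : 0 < s) (hη0 : 0 ≤ η) (hη : η < c * √smin)
    (hv : |v - s| ≤ 2 * √s * η + η ^ 2) :
    |v / s - 1| < 2 * c * √(smin / s) + c ^ 2 * (smin / s) := by
  have hsqrt : √(smin / s) * s = √s * √smin := by
    rw [Real.sqrt_div' _ hs.le, div_mul_comm, Real.div_sqrt]
  rw [div_sub_one hs.ne', abs_div, abs_of_pos hs, div_lt_iff₀ hs]
  refine (abs_sub_lt_of_abs_sub_le hsmin hη0 hη hv).trans_eq ?_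
  rw [add_mul, mul_assoc _ √(smin / s), hsqrt, mul_assoc _ (smin / s), div_mul_cancel₀ _ hs.ne']

theorem abs_sub_div_lt (hsmin : 0 < smin) (hη0 : 0 ≤ η) (hη : η < c * √smin)
    (hv : |v - s| ≤ 2 * √s * η + η ^ 2) :
    |v - s| / smin < 2 * c * √(s / smin) + c ^ 2 := by
  have hsqrt : √(s / smin) * smin = √s * √smin := by
    rw [Real.sqrt_div' _ hsmin.le, div_mul_comm, Real.div_sqrt, mul_comm]
  rw [div_lt_iff₀ hsmin]
  refine (abs_sub_lt_of_abs_sub_le hsmin hη0 hη hv).trans_eq ?_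
  rw [add_mul, mul_assoc _ √(s / smin), hsqrt]

end ErrorBounds

theorem two_pi_div_mul_sqrt_add_lt {x y : ℝ} (hx : x ≤ 1) (hy : y ≤ 1) :
    2 * π / 100 * √x + π ^ 2 / 10 ^ 4 * y < 0.07 := by
  have hsqrt : √x ≤ 1 := Real.sqrt_le_one.2 hx
  have hpi : π ^ 2 < 10 := by nlinarith [Real.pi_gt_three, Real.pi_lt_d2]
  calc 2 * π / 100 * √x + π ^ 2 / 10 ^ 4 * y ≤ 2 * π / 100 * 1 + π ^ 2 / 10 ^ 4 * 1 := by gcongr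
    _ < 0.07 := by linarith [Real.pi_lt_d2]

theorem error_bounds_of_abs_sub_le {s smin η v : ℝ} (hsmin : 0 < smin) (hη0 : 0 ≤ η)
    (hη : η < π / 100 * √smin) (hv : |v - s| ≤ 2 * √s * η + η ^ 2) :
    (smin ≤ s →
      |v / s - 1| < 2 * π / 100 * √(smin / s) + π ^ 2 / 10 ^ 4 * (smin / s) ∧
      2 * π / 100 * √(smin / s) + π ^ 2 / 10 ^ 4 * (smin / s) < 0.07) ∧
    (s < smin →
      |v - s| / smin < 2 * π / 100 * √(s / smin) + π ^ 2 / 10 ^ 4 ∧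
      2 * π / 100 * √(s / smin) + π ^ 2 / 10 ^ 4 < 0.07) := by
  have hlinear : 2 * (π / 100) = 2 * π / 100 := by ring
  have hsquare : (π / 100) ^ 2 = π ^ 2 / 10 ^ 4 := by ring
  rw [← hlinear, ← hsquare]
  refine ⟨fun h => ?_, fun h => ?_⟩
  · have hratio : smin / s ≤ 1 := (div_le_one (hsmin.trans_le h)).2 h
    refine ⟨abs_div_sub_one_lt hsmin (hsmin.trans_le h) hη0 hη hv, ?_⟩
    rw [hlinear, hsquare]
    exact two_pi_div_mul_sqrt_add_lt hratio hratio
  · refine ⟨abs_sub_div_lt hsmin hη0 hη hv, ?_⟩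
    rw [hlinear, hsquare, ← mul_one (π ^ 2 / 10 ^ 4)]
    exact two_pi_div_mul_sqrt_add_lt ((div_le_one hsmin).2 h.le) le_rfl

open Matrix

/-! ### Gates -/

theorem add_add_cancel_bits {ι : Type*} (a b : ι → ZMod 2) : a + b + b = a := by
  funext i
  simp only [Pi.add_apply, add_assoc, CharTwo.add_self_eq_zero, add_zero]

theorem eq_zero_or_eq_one_zmod_two (a : ZMod 2) : a = 0 ∨ a = 1 := by
  revert a
  decide

theorem sum_zmod_two {M : Type*} [AddCommMonoid M] (g : ZMod 2 → M) : ∑ b, g b = g 0 + g 1 :=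
  Fin.sum_univ_two g

theorem kronecker_one_mulVec_apply {ι κ R : Type*} [NonAssocSemiring R] [Fintype ι]
    [DecidableEq κ] [Fintype κ] (A : Matrix ι ι R) (v : ι × κ → R) (s : ι × κ) :
    ((A ⊗ₖ (1 : Matrix κ κ R)) *ᵥ v) s = (A *ᵥ fun i => v (i, s.2)) s.1 := by
  simp [mulVec, dotProduct, Fintype.sum_prod_type, one_apply]

section Gates

variable {ι κ : Type} [DecidableEq ι] [Fintype ι]

theorem mulVec_ket (A : Matrix κ ι ℂ) (i : ι) : A *ᵥ ket i = fun j => A j i :=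
  mulVec_single_one A i

theorem sum_norm_sq_mulVec {U : Matrix ι ι ℂ} (hU : U ∈ unitaryGroup ι ℂ) (v : ι → ℂ) :
    ∑ i, ‖(U *ᵥ v) i‖ ^ 2 = ∑ i, ‖v i‖ ^ 2 := by
  have hdot (w : ι → ℂ) : ((∑ i, ‖w i‖ ^ 2 : ℝ) : ℂ) = star w ⬝ᵥ w := by
    push_cast
    exact Finset.sum_congr rfl fun i _ => (Complex.conj_mul' (w i)).symm
  apply Complex.ofReal_injective
  rw [hdot, hdot, star_mulVec, ← dotProduct_mulVec, mulVec_mulVec, ← star_eq_conjTranspose,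
    mem_unitaryGroup_iff'.1 hU, one_mulVec]

theorem sum_norm_sq_ket (i : ι) : ∑ j, ‖ket i j‖ ^ 2 = 1 := by
  rw [Finset.sum_eq_single i (fun j _ hj => by simp [ket, hj]) (by simp)]
  simp [ket]

theorem permGate_mulVec {σ : ι → ι} (hσ : σ.Involutive) (v : ι → ℂ) :
    permGate σ *ᵥ v = v ∘ σ := by
  ext i
  have hiff (j : ι) : i = σ j ↔ j = σ i := by rw [eq_comm, hσ.eq_iff]
  simp [permGate, mulVec, dotProduct, hiff]

theorem permGate_mem_unitaryGroup {σ : ι → ι} (hσ : σ.Involutive) :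
    permGate σ ∈ unitaryGroup ι ℂ := by
  rw [mem_unitaryGroup_iff']
  ext i j
  simp [permGate, mul_apply, one_apply, hσ.injective.eq_iff, eq_comm]

theorem diagonal_mem_unitaryGroup {d : ι → ℂ} (hd : ∀ i, ‖d i‖ = 1) :
    diagonal d ∈ unitaryGroup ι ℂ := by
  rw [mem_unitaryGroup_iff', star_eq_conjTranspose, diagonal_conjTranspose, diagonal_mul_diagonal,
    ← diagonal_one]
  congr 1
  ext i
  rw [Pi.star_apply, Complex.star_def, Complex.conj_mul', hd, Complex.ofReal_one, one_pow]

theorem diagonal_mul_permGate (σ : ι → ι) (d : ι → ℂ) :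
    diagonal d * permGate σ = permGate σ * diagonal (d ∘ σ) := by
  ext i j
  simp only [permGate, diagonal_mul, mul_diagonal, of_apply, Function.comp_apply]
  split_ifs with h <;> simp [h]

end Gates

section Involutive

variable {n k : ℕ}

theorem involutive_swap (i j : Fin n) :
    Function.Involutive fun s : AD n k => ((s.1 ∘ Equiv.swap i j, s.2) : AD n k) := by
  intro s
  ext <;> simp

theorem involutive_shift (y : Bits n) :
    Function.Involutive fun s : AD n k => ((s.1 + y, s.2) : AD n k) := by
  intro s
  simp only [add_add_cancel_bits]

theorem involutive_data (g : Bits n → Bits k) :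
    Function.Involutive fun s : AD n k => ((s.1, s.2 + g s.1) : AD n k) := by
  intro s
  simp only [add_add_cancel_bits]

theorem involutive_ancilla {ι : Type*} (g : ι → ZMod 2) :
    Function.Involutive fun s : ι × ZMod 2 => ((s.1, s.2 + g s.1) : ι × ZMod 2) := by
  intro s
  simp only [add_assoc, CharTwo.add_self_eq_zero, add_zero]

end Involutive

theorem inv_sqrt_two_mul_self : ((√2 : ℝ) : ℂ)⁻¹ * ((√2 : ℝ) : ℂ)⁻¹ = 1 / 2 := by
  rw [← mul_inv, ← Complex.ofReal_mul, Real.mul_self_sqrt zero_le_two]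
  norm_num

theorem star_hGate_mul_hGate (a b c : ZMod 2) :
    star (hGate a b) * hGate a c = 1 / 2 * (-1) ^ (a.val * b.val) * (-1) ^ (a.val * c.val) := by
  rw [← inv_sqrt_two_mul_self]
  simp only [hGate, of_apply, star_mul', star_pow, star_neg, star_one, star_inv₀, Complex.star_def,
    Complex.conj_ofReal]
  ring

theorem star_hadamard_mul_hadamard {n : ℕ} (a b c : Bits n) :
    star (hadamard n a b) * hadamard n a c = ∏ j, star (hGate (a j) (b j)) * hGate (a j) (c j) := by
  simp only [hadamard, of_apply, star_prod, Finset.prod_mul_distrib]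

theorem hadamard_mem_unitaryGroup (n : ℕ) : hadamard n ∈ unitaryGroup (Bits n) ℂ := by
  have hgate (b c : ZMod 2) : ∑ a, star (hGate a b) * hGate a c = if b = c then 1 else 0 := by
    simp only [star_hGate_mul_hGate, sum_zmod_two]
    rcases eq_zero_or_eq_one_zmod_two b with rfl | rfl <;>
      rcases eq_zero_or_eq_one_zmod_two c with rfl | rfl <;> norm_num [ZMod.val_one]
  rw [mem_unitaryGroup_iff']
  ext b c
  simp only [star_eq_conjTranspose, mul_apply, conjTranspose_apply, star_hadamard_mul_hadamard]
  rw [← Fintype.prod_sum fun j a => star (hGate a (b j)) * hGate a (c j)]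
  simp only [hgate, Finset.prod_ite_zero, Finset.prod_const_one, Finset.mem_univ, true_imp_iff,
    one_apply, funext_iff]

/-! ### Alice's tests -/

section Tests

variable {n k : ℕ} [NeZero n]

/-- `SWAP(0,m) Z(x) X_0^b V(μ,ν)`, the part of `U_t` after the Hadamard gates. -/
noncomputable def testPrep (d : TestData n k) : Matrix (AD n k) (AD n k) ℂ :=
  let swapGate : Matrix (AD n k) (AD n k) ℂ := permGate fun s => (s.1 ∘ Equiv.swap 0 d.2.1, s.2)
  let zGate : Matrix (AD n k) (AD n k) ℂ :=
    diagonal fun s => ∏ j, (-1) ^ ((d.2.2.1 j).val * (s.1 j).val)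
  let xGate : Matrix (AD n k) (AD n k) ℂ := permGate fun s => (s.1 + Pi.single 0 d.2.2.2, s.2)
  let V : Matrix (AD n k) (AD n k) ℂ :=
    permGate fun s => (s.1, s.2 + if s.1 0 = 0 then d.1.1.1 else d.1.1.2)
  swapGate * zGate * xGate * V

theorem Ut_eq (d : TestData n k) :
    Ut d = testPrep d * (hadamard n ⊗ₖ (1 : Matrix (Bits k) (Bits k) ℂ)) := rfl

theorem testPrep_mem_unitaryGroup (d : TestData n k) : testPrep d ∈ unitaryGroup (AD n k) ℂ := by
  refine mul_mem (mul_mem (mul_mem (permGate_mem_unitaryGroup (involutive_swap _ _))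
    (diagonal_mem_unitaryGroup fun s => ?_)) (permGate_mem_unitaryGroup (involutive_shift _)))
    (permGate_mem_unitaryGroup (involutive_data fun a => if a 0 = 0 then d.1.1.1 else d.1.1.2))
  simp only [norm_prod, norm_pow, norm_neg, norm_one, one_pow, Finset.prod_const_one]

theorem Ut_mem_unitaryGroup (d : TestData n k) : Ut d ∈ unitaryGroup (AD n k) ℂ :=
  mul_mem (testPrep_mem_unitaryGroup d)
    (kronecker_mem_unitary (hadamard_mem_unitaryGroup n) (one_mem _))

/-- The data string `μ` or `ν` of a test, selected by the first address qubit. -/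
def testString (d : TestData n k) (b : ZMod 2) : Bits k :=
  if b = 0 then d.1.1.1 else d.1.1.2

theorem diagonal_mul_testPrep (d : TestData n k) (h : Bits k → ℂ) :
    diagonal (fun s => h s.2) * testPrep d =
      testPrep d * diagonal fun s => h (s.2 + testString d (s.1 0)) := by
  -- among the factors of `testPrep d`, only `V` acts on the data register
  simp only [testPrep, Matrix.mul_assoc]
  rw [← Matrix.mul_assoc, diagonal_mul_permGate, Matrix.mul_assoc, ← Matrix.mul_assoc (diagonal _),
    (commute_diagonal _ _).eq, Matrix.mul_assoc, ← Matrix.mul_assoc (diagonal (_ ∘ _)),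
    diagonal_mul_permGate, Matrix.mul_assoc, diagonal_mul_permGate]
  rfl

theorem Ut_conj_diagonal (d : TestData n k) (h : Bits k → ℂ) :
    (Ut d)ᴴ * diagonal (fun s => h s.2) * Ut d =
      ((hadamard n)ᴴ ⊗ₖ (1 : Matrix (Bits k) (Bits k) ℂ)) *
        diagonal (fun s => h (s.2 + testString d (s.1 0))) *
        (hadamard n ⊗ₖ (1 : Matrix (Bits k) (Bits k) ℂ)) := by
  have hunit : (testPrep d)ᴴ * testPrep d = 1 :=
    mem_unitaryGroup_iff'.1 (testPrep_mem_unitaryGroup d)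
  rw [Ut_eq, conjTranspose_mul, Matrix.mul_assoc, Matrix.mul_assoc,
    ← Matrix.mul_assoc (diagonal _) (testPrep d), diagonal_mul_testPrep, Matrix.mul_assoc,
    ← Matrix.mul_assoc (testPrep d)ᴴ, hunit, Matrix.one_mul, ← Matrix.mul_assoc,
    conjTranspose_kronecker, conjTranspose_one]

theorem hadamard_conj_diagonal_apply (P : ZMod 2 → ℂ) (v : Bits n) :
    ((hadamard n)ᴴ * diagonal (fun a : Bits n => P (a 0)) * hadamard n) v 0 =
      if ∀ j ≠ 0, v j = 0 then (P 0 + P 1 * (-1) ^ (v 0).val) / 2 else 0 := by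
  have hterm (a : Bits n) : star (hadamard n a v) * P (a 0) * hadamard n a 0 =
      ∏ j, (if j = 0 then P (a j) else 1) * (1 / 2 * (-1) ^ ((a j).val * (v j).val)) := by
    rw [mul_right_comm, star_hadamard_mul_hadamard, mul_comm]
    simp only [star_hGate_mul_hGate, Pi.zero_apply, ZMod.val_zero, mul_zero, pow_zero, mul_one]
    rw [Finset.prod_mul_distrib (f := fun j => if j = 0 then P (a j) else 1),
      Finset.prod_ite_eq' Finset.univ (0 : Fin n) fun j => P (a j), if_pos (Finset.mem_univ _)]
  have hfactor (j : Fin n) (hj : j ≠ 0) :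
      ∑ b : ZMod 2, (if j = 0 then P b else 1) * (1 / 2 * (-1 : ℂ) ^ (b.val * (v j).val)) =
        if v j = 0 then 1 else 0 := by
    simp only [sum_zmod_two, if_neg hj]
    rcases eq_zero_or_eq_one_zmod_two (v j) with h | h <;> norm_num [h, ZMod.val_one]
  rw [mul_apply]
  simp only [mul_diagonal, conjTranspose_apply, hterm]
  rw [← Fintype.prod_sum fun (j : Fin n) (b : ZMod 2) =>
      (if j = 0 then P b else 1) * (1 / 2 * (-1 : ℂ) ^ (b.val * (v j).val)),
    ← Finset.mul_prod_erase Finset.univ _ (Finset.mem_univ (0 : Fin n)),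
    Finset.prod_congr rfl fun j hj => hfactor j (Finset.ne_of_mem_erase hj), Finset.prod_ite_zero,
    sum_zmod_two]
  simp only [Finset.mem_erase, Finset.mem_univ, and_true, Finset.prod_const_one, if_true,
    ZMod.val_zero, ZMod.val_one, zero_mul, one_mul, pow_zero, mul_ite, mul_one, mul_zero]
  congr 1
  ring

/-- All bits of the address and data registers are `0`, except possibly the first address bit: the
condition under which honest Bob passes. -/
def OnlyFirstBit (s : AD n k) : Prop :=
  s.2 = 0 ∧ ∀ j ≠ 0, s.1 j = 0

theorem onlyFirstBit_iff {s : AD n k} : OnlyFirstBit s ↔ s = (Pi.single 0 (s.1 0), 0) := by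
  rw [OnlyFirstBit, Prod.ext_iff, and_comm]
  refine and_congr_left' ⟨fun h => funext fun j => ?_, fun h j hj => ?_⟩
  · rcases eq_or_ne j 0 with rfl | hj
    · simp
    · simp [h j hj, hj]
  · exact (congrFun h j).trans (Pi.single_eq_of_ne hj _)

open Classical in
theorem Ut_conj_diagonal_mulVec_ket (d : TestData n k) (h : Bits k → ℂ) (s : AD n k) :
    (((Ut d)ᴴ * diagonal (fun s => h s.2) * Ut d) *ᵥ ket (0, 0)) s =
      if OnlyFirstBit s then
        (h (testString d 0) + h (testString d 1) * (-1) ^ (s.1 0).val) / 2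
      else 0 := by
  rw [Ut_conj_diagonal, Matrix.mul_assoc, ← mulVec_mulVec, mulVec_ket, kronecker_one_mulVec_apply]
  simp only [diagonal_mul, kroneckerMap_apply, one_apply]
  by_cases hs : s.2 = 0
  · have key := hadamard_conj_diagonal_apply (fun b => h (testString d b)) s.1
    rw [Matrix.mul_assoc, mul_apply] at key
    simpa [OnlyFirstBit, hs, mulVec, dotProduct] using key
  · simp [OnlyFirstBit, hs, mulVec, dotProduct]

theorem norm_sq_test1State (d : TestData n k) (g : Bits k → ZMod 2) (s : AD n k) :
    ‖(((Ut d)ᴴ * Uf n g * Ut d) *ᵥ ket (0, 0)) s‖ ^ 2 =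
      if s = (Pi.single 0 (g (testString d 0) + g (testString d 1)), 0) then 1 else 0 := by
  classical
  rw [Uf, Ut_conj_diagonal_mulVec_ket d fun τ => (-1) ^ (g τ).val]
  by_cases hs : OnlyFirstBit s
  · have hiff : s = (Pi.single 0 (g (testString d 0) + g (testString d 1)), 0) ↔
        s.1 0 = g (testString d 0) + g (testString d 1) :=
      ⟨fun h => by simp [h], fun h => h ▸ onlyFirstBit_iff.1 hs⟩
    rw [if_pos hs, if_congr hiff rfl rfl]
    rcases eq_zero_or_eq_one_zmod_two (s.1 0) with hx | hx <;>
      rcases eq_zero_or_eq_one_zmod_two (g (testString d 0)) with ha | ha <;>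
      rcases eq_zero_or_eq_one_zmod_two (g (testString d 1)) with hb | hb <;>
      norm_num [hx, ha, hb, ZMod.val_one, CharTwo.add_self_eq_zero]
  · rw [if_neg hs, if_neg fun h => hs (onlyFirstBit_iff.2 (by simp [h])),
      norm_zero, zero_pow two_ne_zero]

instance [NeZero k] : Nonempty (TestData n k) := by
  refine ⟨⟨⟨(0, Pi.single 0 1), ?_⟩, 0, 0, 0⟩⟩
  simp only [binVal, Pi.zero_apply, ZMod.val_zero, zero_mul, Finset.sum_const_zero]
  refine Finset.sum_pos' (fun _ _ => Nat.zero_le _) ⟨0, Finset.mem_univ _, ?_⟩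
  simp [ZMod.val_one]

theorem sum_div_card_eq_one {ι : Type*} [Fintype ι] [Nonempty ι] {q : ι → ℝ} (hq : ∀ i, q i = 1) :
    (∑ i, q i) / Fintype.card ι = 1 := by
  simp [hq]

theorem passTest1_eq_one [NeZero k] (g : Bits k → ZMod 2) : passTest1 n g = 1 := by
  classical
  refine sum_div_card_eq_one fun d => ?_
  simp only [norm_sq_test1State]
  set s₀ : AD n k := (Pi.single 0 (g (testString d 0) + g (testString d 1)), 0)
  rw [Finset.sum_eq_single s₀ (fun v _ hv => by simp [hv]) (by simp),
    Finset.sum_eq_single s₀ (fun w _ hw => by simp [hw]) (by simp), if_pos, if_pos rfl, mul_one]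
  have hs₀ (j : Fin n) (hj : j ≠ 0) : s₀.1 j = 0 := Pi.single_eq_of_ne hj _
  exact ⟨rfl, fun j hj => ⟨hs₀ j hj, hs₀ j hj⟩, rfl, rfl⟩

theorem kronecker_one_conj_ancilla_mulVec_ket {ι : Type} [DecidableEq ι] [Fintype ι]
    (A B : Matrix ι ι ℂ) (g : ι → ZMod 2) (i : ι) (s : ι × ZMod 2) :
    (((A ⊗ₖ (1 : Matrix (ZMod 2) (ZMod 2) ℂ))ᴴ * permGate (fun s => (s.1, s.2 + g s.1)) *
        (B ⊗ₖ (1 : Matrix (ZMod 2) (ZMod 2) ℂ))) *ᵥ ket (i, 0)) s =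
      ((Aᴴ * diagonal (fun j => if g j = s.2 then 1 else 0) * B) *ᵥ ket i) s.1 := by
  have hslice (j : ι) : s.2 + g j = 0 ↔ g j = s.2 :=
    CharTwo.add_eq_zero.trans eq_comm
  rw [conjTranspose_kronecker, conjTranspose_one, ← mulVec_mulVec, ← mulVec_mulVec,
    kronecker_one_mulVec_apply, permGate_mulVec (involutive_ancilla g), ← mulVec_mulVec,
    ← mulVec_mulVec, mulVec_ket, mulVec_ket]
  congr 2
  ext j
  simp [mulVec_diagonal, one_apply, hslice]

/-- The state of `q_a, q_d, q_g` that honest Bob returns in TestBob2. -/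
noncomputable def test2State (d : TestData n k) (f : Bits k → ZMod 2) : AD n k × ZMod 2 → ℂ :=
  ((Ut d ⊗ₖ (1 : Matrix (ZMod 2) (ZMod 2) ℂ))ᴴ * permGate (fun s => (s.1, s.2 + f s.1.2)) *
    (Ut d ⊗ₖ (1 : Matrix (ZMod 2) (ZMod 2) ℂ))) *ᵥ ket ((0, 0), 0)

theorem test2State_eq_zero (d : TestData n k) (f : Bits k → ZMod 2) {s : AD n k × ZMod 2}
    (hs : ¬OnlyFirstBit s.1) : test2State d f s = 0 := by
  classical
  rw [test2State, kronecker_one_conj_ancilla_mulVec_ket (Ut d) (Ut d) fun s => f s.2,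
    Ut_conj_diagonal_mulVec_ket d fun τ => if f τ = s.2 then 1 else 0, if_neg hs]

theorem sum_norm_sq_test2State (d : TestData n k) (f : Bits k → ZMod 2) :
    ∑ s, ‖test2State d f s‖ ^ 2 = 1 := by
  have hU : Ut d ⊗ₖ (1 : Matrix (ZMod 2) (ZMod 2) ℂ) ∈ unitaryGroup (AD n k × ZMod 2) ℂ :=
    kronecker_mem_unitary (Ut_mem_unitaryGroup d) (one_mem _)
  have hperm := permGate_mem_unitaryGroup (involutive_ancilla fun s : AD n k => f s.2)
  exact (sum_norm_sq_mulVec (mul_mem (mul_mem (Unitary.star_mem hU) hperm) hU) _).trans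
    (sum_norm_sq_ket _)

theorem swapTest_mulVec_apply_zero {S : Type} [Fintype S] [DecidableEq (S × S)]
    [DecidableEq (ZMod 2 × S × S)] (Φ : S → ℂ) (v w : S) :
    ((hGate ⊗ₖ (1 : Matrix (S × S) (S × S) ℂ) *
        permGate fun s => if s.1 = 1 then (s.1, s.2.2, s.2.1) else s) *ᵥ
      fun s => ((√2 : ℝ) : ℂ)⁻¹ * Φ s.2.1 * Φ s.2.2) (0, v, w) = Φ v * Φ w := by
  have hinv : Function.Involutive fun s : ZMod 2 × S × S =>
      if s.1 = 1 then (s.1, s.2.2, s.2.1) else s := by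
    rintro ⟨a, b, c⟩
    by_cases ha : a = 1 <;> simp [ha]
  rw [← mulVec_mulVec, permGate_mulVec hinv, kronecker_one_mulVec_apply]
  simp only [mulVec, dotProduct, hGate, of_apply, ZMod.val_zero, zero_mul, pow_zero, mul_one,
    Function.comp_apply, sum_zmod_two, zero_ne_one, ↓reduceIte]
  linear_combination (2 * Φ v * Φ w) * inv_sqrt_two_mul_self

theorem passTest2_eq_one [NeZero k] (f : Bits k → ZMod 2) : passTest2 n f = 1 := by
  classical
  refine sum_div_card_eq_one fun d => ?_
  have hprob : ∑ v, ∑ w, ‖test2State d f v‖ ^ 2 * ‖test2State d f w‖ ^ 2 = 1 := by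
    rw [← Finset.sum_mul_sum, sum_norm_sq_test2State, mul_one]
  rw [← hprob]
  refine Finset.sum_congr rfl fun v _ => Finset.sum_congr rfl fun w _ => ?_
  rw [← mul_pow, ← norm_mul]
  split_ifs with h
  · exact congrArg (fun z : ℂ => ‖z‖ ^ 2) (swapTest_mulVec_apply_zero (test2State d f) v w)
  · by_cases hv : OnlyFirstBit v.1
    · rw [test2State_eq_zero d f fun hw : OnlyFirstBit w.1 =>
        h ⟨fun j hj => ⟨hv.2 j hj, hw.2 j hj⟩, hv.1, hw.1⟩]
      simp
    · rw [test2State_eq_zero d f hv]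
      simp

end Tests

theorem survive_one (p : ℝ) : survive p 1 = 1 := by
  simp only [survive, ite_self, intervalIntegral.integral_const, sub_zero, one_smul]

/-! ### Binary values -/

section BinVal

variable {t : ℕ}

theorem binVal_insert {M : Finset (Fin t)} {a : Fin t} (ha : ∀ x ∈ M, a < x) (c : Bits t) :
    binVal (insert a M) c = (c a).val * 2 ^ M.card + binVal M c := by
  have hfilter : (insert a M).filter (fun v => a < v) = M := by
    rw [Finset.filter_insert, if_neg (lt_irrefl a), Finset.filter_true_of_mem ha]
  rw [binVal, Finset.sum_insert fun h => (ha a h).false, hfilter, binVal]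
  congr 1
  refine Finset.sum_congr rfl fun w hw => ?_
  rw [Finset.filter_insert, if_neg (ha w hw).not_gt]

theorem sum_agree_insert {R : Type*} [AddCommMonoid R] {M : Finset (Fin t)} {a : Fin t}
    (ha : a ∉ M) (c' : Bits t) (G : Bits t → R) :
    (∑ c, if ∀ w, w ∉ insert a M → c' w = c w then G c else 0) =
      ∑ b, ∑ c, if ∀ w, w ∉ M → Function.update c' a b w = c w then G c else 0 := by
  rw [Finset.sum_comm]
  refine Finset.sum_congr rfl fun c _ => ?_
  have hiff : (∀ w, w ∉ insert a M → c' w = c w) ↔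
      ∀ w, w ∉ M → Function.update c' a (c a) w = c w := by
    refine forall_congr' fun w => ?_
    rcases eq_or_ne w a with rfl | hw
    · simp
    · simp [hw]
  rw [Finset.sum_eq_single (c a) (fun b _ hb => if_neg fun h => hb ?_) (by simp)]
  · exact if_congr hiff rfl rfl
  · rw [← h a ha, Function.update_self]

theorem sum_agree_binVal {R : Type*} [AddCommMonoid R] (M : Finset (Fin t)) (g : ℕ → R)
    (c' : Bits t) :
    (∑ c, if ∀ w, w ∉ M → c' w = c w then g (binVal M c) else 0) =
      ∑ m ∈ Finset.range (2 ^ M.card), g m := by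
  induction M using Finset.induction_on_min generalizing g c' with
  | empty => simp [← funext_iff, binVal]
  | insert a M ha ih =>
    have haM : a ∉ M := fun h => (ha a h).false
    have hbit (b : ZMod 2) :
        (∑ c, if ∀ w, w ∉ M → Function.update c' a b w = c w then
          g (binVal (insert a M) c) else 0) =
          ∑ m ∈ Finset.range (2 ^ M.card), g (b.val * 2 ^ M.card + m) := by
      rw [← ih (fun m => g (b.val * 2 ^ M.card + m)) (Function.update c' a b)]
      refine Finset.sum_congr rfl fun c _ => ?_
      split_ifs with h
      · rw [binVal_insert ha, ← h a haM, Function.update_self]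
      · rfl
    rw [sum_agree_insert haM c' fun c => g (binVal (insert a M) c), sum_zmod_two, hbit, hbit,
      Finset.card_insert_of_notMem haM, pow_succ, mul_two, Finset.sum_range_add]
    simp only [ZMod.val_zero, ZMod.val_one, zero_mul, zero_add, one_mul]

theorem sum_binVal (M : Finset (Fin t)) (g : ℕ → ℝ) :
    ∑ c : Bits t, g (binVal M c) =
      2 ^ t / 2 ^ M.card * ∑ m ∈ Finset.range (2 ^ M.card), g m := by
  have hcard (c : Bits t) : (∑ c' : Bits t, if ∀ w, w ∉ M → c' w = c w then (1 : ℝ) else 0) =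
      2 ^ M.card := by
    simp only [eq_comm (b := c _), sum_agree_binVal M fun _ => (1 : ℝ)]
    simp
  have hdouble : ∑ c' : Bits t, ∑ c : Bits t,
      (if ∀ w, w ∉ M → c' w = c w then g (binVal M c) else 0) =
        2 ^ M.card * ∑ c : Bits t, g (binVal M c) := by
    rw [Finset.sum_comm, Finset.mul_sum]
    refine Finset.sum_congr rfl fun c _ => ?_
    rw [← hcard c, Finset.sum_mul]
    simp only [ite_mul, one_mul, zero_mul]
  simp only [sum_agree_binVal M g, Finset.sum_const, Finset.card_univ, nsmul_eq_mul,
    Fintype.card_fun, ZMod.card, Fintype.card_fin] at hdouble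
  push_cast at hdouble
  rw [div_mul_eq_mul_div, hdouble, mul_div_cancel_left₀ _ (by positivity)]

end BinVal

/-! ### Grover iterations -/

section Grover

variable {n k : ℕ} (D : Database n k) (y : Bits n)

theorem UD_mulVec (v : AD n k → ℂ) : UD D y *ᵥ v = fun s => v (s.1, s.2 + D (s.1 + y)) := by
  rw [UD, shiftX, oracle, ← mulVec_mulVec, ← mulVec_mulVec, permGate_mulVec (involutive_shift y),
    permGate_mulVec (involutive_data D), permGate_mulVec (involutive_shift y)]
  funext s
  simp only [Function.comp_apply, add_add_cancel_bits]

theorem plusKet_mul_plusKet (m : ℕ) (x x' : Bits m) : plusKet m x * plusKet m x' = (2 ^ m)⁻¹ := by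
  rw [plusKet, plusKet, ← mul_inv, ← Complex.ofReal_mul, Real.mul_self_sqrt (by positivity)]
  push_cast
  rfl

theorem norm_plusKet_sq (m : ℕ) (x : Bits m) : ‖plusKet m x‖ ^ 2 = (2 ^ m)⁻¹ := by
  rw [← norm_pow, sq, plusKet_mul_plusKet, norm_inv, norm_pow, Complex.norm_ofNat]

theorem Gbar_mulVec (v : AD n k → ℂ) (s : AD n k) :
    (Gbar n k *ᵥ v) s = v s - 2 * (2 ^ n)⁻¹ * ∑ x, v (x, s.2) := by
  have hstar (x : Bits n) : star (plusKet n x) = plusKet n x := by simp [plusKet]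
  rw [Gbar, kronecker_one_mulVec_apply, sub_mulVec, one_mulVec, smul_mulVec, vecMulVec_mulVec]
  simp only [Pi.sub_apply, Pi.smul_apply, dotProduct, Pi.star_apply, hstar, smul_eq_mul,
    MulOpposite.smul_eq_mul_unop, MulOpposite.unop_op, Finset.mul_sum]
  congr 1
  refine Finset.sum_congr rfl fun x _ => ?_
  rw [← plusKet_mul_plusKet n s.1 x]
  ring

theorem iter_mulVec (f : Bits k → ZMod 2) (v : AD n k → ℂ) (s : AD n k) :
    (iter D y f *ᵥ v) s = (-1) ^ (f (s.2 + D (s.1 + y))).val * v s -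
      2 * (2 ^ n)⁻¹ * ∑ x, (-1) ^ (f (s.2 + D (x + y))).val * v (x, s.2) := by
  rw [iter, ← mulVec_mulVec, ← mulVec_mulVec, ← mulVec_mulVec, Gbar_mulVec]
  simp only [UD_mulVec, Uf, mulVec_diagonal, add_add_cancel_bits]

variable {D} {f : Bits k → ZMod 2}

theorem sum_ite_eq_frac {E : Type*} [AddCommGroup E] [Module ℝ E] (a b : E) :
    ∑ x : Bits n, (if f (D (x + y)) = 1 then a else b) =
      (2 ^ n : ℝ) • (frac D f • a + (1 - frac D f) • b) := by
  have hval : ∑ x : Bits n, ((f (D (x + y))).val : ℝ) = 2 ^ n * frac D f := by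
    rw [frac, ← mul_assoc, mul_one_div_cancel (by positivity), one_mul]
    exact Equiv.sum_comp (Equiv.addRight y) fun x => ((f (D x)).val : ℝ)
  have hterm (x : Bits n) : (if f (D (x + y)) = 1 then a else b) =
      ((f (D (x + y))).val : ℝ) • (a - b) + b := by
    rcases eq_zero_or_eq_one_zmod_two (f (D (x + y))) with h | h <;> simp [h, ZMod.val_one]
  simp only [hterm, Finset.sum_add_distrib, ← Finset.sum_smul, hval, Finset.sum_const,
    Finset.card_univ, Fintype.card_fun, ZMod.card, Fintype.card_fin, ← Nat.cast_smul_eq_nsmul ℝ]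
  push_cast
  module

theorem frac_pos_of_eq_one {x : Bits n} (hx : f (D (x + y)) = 1) : 0 < frac D f := by
  have hpos : 0 < ∑ x : Bits n, if f (D (x + y)) = 1 then (1 : ℝ) else 0 :=
    Finset.sum_pos' (fun x _ => by positivity) ⟨x, Finset.mem_univ x, by simp [hx]⟩
  rw [sum_ite_eq_frac] at hpos
  simpa using hpos

theorem frac_lt_one_of_ne_one {x : Bits n} (hx : f (D (x + y)) ≠ 1) : frac D f < 1 := by
  have hpos : 0 < ∑ x : Bits n, if f (D (x + y)) = 1 then (0 : ℝ) else 1 :=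
    Finset.sum_pos' (fun x _ => by positivity) ⟨x, Finset.mem_univ x, by simp [hx]⟩
  rw [sum_ite_eq_frac] at hpos
  simpa using hpos

variable (D f) in
theorem frac_nonneg : 0 ≤ frac D f := by
  rw [frac]
  positivity

variable (D f) in
theorem frac_le_one : frac D f ≤ 1 := by
  have hnonneg : 0 ≤ ∑ x : Bits n, if f (D (x + 0)) = 1 then (0 : ℝ) else 1 :=
    Finset.sum_nonneg fun x _ => by positivity
  rw [sum_ite_eq_frac] at hnonneg
  simpa using hnonneg

/-- The initial state `|+⟩^{⊗ n} |0⟩` of the address and data registers. -/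
noncomputable def startAD (n k : ℕ) : AD n k → ℂ :=
  fun s => plusKet n s.1 * ket (0 : Bits k) s.2

variable (D f) in
/-- These vectors form the plane that contains the initial state and is invariant under the Grover
iteration: `A` and `B` are the amplitudes, relative to the initial state, of the addresses `x` with
`f (D (x + y)) = 1` and of the other addresses. -/
noncomputable def planeVec (A B : ℂ) : AD n k → ℂ :=
  fun s => startAD n k s * if f (D (s.1 + y)) = 1 then A else B

theorem planeVec_one_one : planeVec D y f 1 1 = startAD n k := by
  funext s
  rw [planeVec, ite_self, mul_one]

theorem planeVec_congr {A A' B B' : ℂ} (hA : 0 < frac D f → A = A') (hB : frac D f < 1 → B = B') :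
    planeVec D y f A B = planeVec D y f A' B' := by
  funext s
  by_cases hs : f (D (s.1 + y)) = 1
  · simp only [planeVec, if_pos hs, hA (frac_pos_of_eq_one y hs)]
  · simp only [planeVec, if_neg hs, hB (frac_lt_one_of_ne_one y hs)]

theorem smul_planeVec (c A B : ℂ) :
    c • planeVec D y f A B = planeVec D y f (c * A) (c * B) := by
  funext s
  simp only [planeVec, Pi.smul_apply, smul_eq_mul]
  split_ifs <;> ring

theorem planeVec_add_planeVec (A B A' B' : ℂ) :
    planeVec D y f A B + planeVec D y f A' B' = planeVec D y f (A + A') (B + B') := by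
  funext s
  simp only [planeVec, Pi.add_apply]
  split_ifs <;> ring

theorem sum_norm_sq_planeVec (A B : ℂ) :
    ∑ s, ‖planeVec D y f A B s‖ ^ 2 = frac D f * ‖A‖ ^ 2 + (1 - frac D f) * ‖B‖ ^ 2 := by
  have haddr (x : Bits n) : ∑ τ, ‖planeVec D y f A B (x, τ)‖ ^ 2 =
      (2 ^ n)⁻¹ * if f (D (x + y)) = 1 then ‖A‖ ^ 2 else ‖B‖ ^ 2 := by
    rw [Finset.sum_eq_single 0 (fun τ _ hτ => by simp [planeVec, startAD, ket, hτ]) (by simp)]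
    simp only [planeVec, startAD, ket, Pi.single_eq_same, mul_one, norm_mul, mul_pow,
      norm_plusKet_sq, apply_ite (fun z : ℂ => ‖z‖ ^ 2)]
  rw [Fintype.sum_prod_type]
  simp only [haddr, ← Finset.mul_sum, sum_ite_eq_frac, smul_eq_mul]
  rw [inv_mul_cancel_left₀ (by positivity)]

theorem iter_mulVec_planeVec (A B : ℂ) :
    iter D y f *ᵥ planeVec D y f A B =
      planeVec D y f (-A - 2 * ((1 - frac D f) * B - frac D f * A))
        (B - 2 * ((1 - frac D f) * B - frac D f * A)) := by
  funext ⟨x, τ⟩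
  rw [iter_mulVec]
  rcases eq_or_ne τ 0 with rfl | hτ
  · have hterm (x' : Bits n) : (-1) ^ (f (0 + D (x' + y))).val * planeVec D y f A B (x', 0) =
        plusKet n x * if f (D (x' + y)) = 1 then -A else B := by
      rcases eq_zero_or_eq_one_zmod_two (f (D (x' + y))) with h | h <;>
        simp [planeVec, startAD, ket, plusKet, h, ZMod.val_one]
    simp only [hterm, ← Finset.mul_sum, sum_ite_eq_frac, Complex.real_smul]
    simp only [planeVec, startAD, ket, Pi.single_eq_same, mul_one]
    push_cast
    split_ifs <;> field_simp <;> ring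
  · simp [planeVec, startAD, ket, hτ]

/-- An eigenvector of the Grover iteration, for an angle `ψ` with `sin² ψ = f(D)`. If `sin ψ` or
`cos ψ` is `0`, the amplitude that it divides belongs to no address. -/
noncomputable def groverEigenvec (D : Database n k) (y : Bits n) (f : Bits k → ZMod 2) (ψ : ℝ) :
    AD n k → ℂ :=
  planeVec D y f (-Complex.I / (Real.sin ψ : ℂ)) (1 / (Real.cos ψ : ℂ))

theorem sin_ne_zero_of_frac_pos {ψ : ℝ} (hψ : Real.sin ψ ^ 2 = frac D f) (hpos : 0 < frac D f) :
    Real.sin ψ ≠ 0 :=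
  (pow_ne_zero_iff two_ne_zero).1 (hψ.trans_ne hpos.ne')

theorem cos_ne_zero_of_frac_lt_one {ψ : ℝ} (hψ : Real.sin ψ ^ 2 = frac D f)
    (hlt : frac D f < 1) : Real.cos ψ ≠ 0 := by
  intro hcos
  rw [← hψ, Real.sin_sq, hcos] at hlt
  norm_num at hlt

theorem iter_mulVec_groverEigenvec {ψ : ℝ} (hψ : Real.sin ψ ^ 2 = frac D f) :
    iter D y f *ᵥ groverEigenvec D y f ψ =
      (-Complex.exp (2 * ψ * Complex.I)) • groverEigenvec D y f ψ := by
  have hcos : (Real.cos ψ : ℂ) ^ 2 = 1 - frac D f := by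
    rw [← hψ]
    exact_mod_cast Real.cos_sq' ψ
  have hsin : (Real.sin ψ : ℂ) ^ 2 = frac D f := by exact_mod_cast hψ
  have hexp : Complex.exp (2 * ψ * Complex.I) =
      (Real.cos ψ + Real.sin ψ * Complex.I) ^ 2 := by
    rw [mul_assoc, ← Nat.cast_ofNat, Complex.exp_nat_mul, Complex.exp_mul_I, Complex.ofReal_cos,
      Complex.ofReal_sin]
  have hmean : (1 - frac D f) * (1 / (Real.cos ψ : ℂ)) - frac D f * (-Complex.I / Real.sin ψ) =
      Real.cos ψ + Real.sin ψ * Complex.I := by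
    rw [← hcos, ← hsin]
    field_simp
    ring
  have hone : (Real.cos ψ : ℂ) ^ 2 + (Real.sin ψ : ℂ) ^ 2 = 1 := by rw [hcos, hsin, sub_add_cancel]
  rw [groverEigenvec, iter_mulVec_planeVec, smul_planeVec, hmean, hexp]
  refine planeVec_congr y (fun h => ?_) fun h => ?_
  · have hs := Complex.ofReal_ne_zero.2 (sin_ne_zero_of_frac_pos hψ h)
    field_simp
    linear_combination (-Complex.I) * hone - (2 * (Real.sin ψ : ℂ) * Real.cos ψ +
      Complex.I * (Real.sin ψ : ℂ) ^ 2) * Complex.I_sq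
  · have hc := Complex.ofReal_ne_zero.2 (cos_ne_zero_of_frac_lt_one hψ h)
    field_simp
    linear_combination (-1 : ℂ) * hone + (Real.sin ψ : ℂ) ^ 2 * Complex.I_sq

theorem pow_mulVec_of_mulVec_eq_smul {ι R : Type*} [CommSemiring R] [Fintype ι] [DecidableEq ι]
    {A : Matrix ι ι R} {v : ι → R} {c : R} (h : A *ᵥ v = c • v) (m : ℕ) :
    A ^ m *ᵥ v = c ^ m • v := by
  induction m with
  | zero => simp
  | succ m ih => rw [pow_succ', ← mulVec_mulVec, ih, mulVec_smul, h, smul_smul, pow_succ]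

theorem sum_smul_iter_pow_mulVec_groverEigenvec {ψ : ℝ} (hψ : Real.sin ψ ^ 2 = frac D f) {T : ℕ}
    (hT : T ≠ 0) (α : ℝ) :
    ∑ m ∈ Finset.range T, Complex.exp (Complex.I * α) ^ m •
        (iter D y f ^ m *ᵥ groverEigenvec D y f ψ) =
      (T * phaseAmp T (α + (π + 2 * ψ))) • groverEigenvec D y f ψ := by
  have hexp : Complex.exp (Complex.I * α) * -Complex.exp (2 * ψ * Complex.I) =
      Complex.exp (Complex.I * ((α + (π + 2 * ψ) : ℝ) : ℂ)) := by
    rw [neg_eq_neg_one_mul, ← Complex.exp_pi_mul_I, ← Complex.exp_add, ← Complex.exp_add]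
    congr 1
    push_cast
    ring
  simp only [pow_mulVec_of_mulVec_eq_smul (iter_mulVec_groverEigenvec y hψ), smul_smul,
    ← mul_pow, hexp, ← Finset.sum_smul]
  rw [phaseAmp, mul_inv_cancel_left₀ (Nat.cast_ne_zero.2 hT)]

variable (D f) in
/-- The angle `φ ∈ [0, π / 2]` with `sin² φ = f(D)`. -/
noncomputable def angle : ℝ :=
  Real.arcsin √(frac D f)

variable (D f) in
theorem sin_angle : Real.sin (angle D f) = √(frac D f) :=
  Real.sin_arcsin (neg_one_lt_zero.le.trans (Real.sqrt_nonneg _)) <|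
    Real.sqrt_le_one.2 (frac_le_one D f)

variable (D f) in
theorem sin_angle_sq : Real.sin (angle D f) ^ 2 = frac D f := by
  rw [sin_angle, Real.sq_sqrt (frac_nonneg D f)]

theorem startAD_eq_groverEigenvec_add :
    startAD n k = (Complex.exp (angle D f * Complex.I) / 2) • groverEigenvec D y f (angle D f) +
      (Complex.exp (-angle D f * Complex.I) / 2) • groverEigenvec D y f (-angle D f) := by
  rw [groverEigenvec, groverEigenvec, Real.sin_neg, Real.cos_neg, Complex.exp_mul_I,
    Complex.exp_mul_I, Complex.cos_neg, Complex.sin_neg, ← Complex.ofReal_cos,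
    ← Complex.ofReal_sin, Complex.ofReal_neg, smul_planeVec, smul_planeVec, planeVec_add_planeVec,
    ← planeVec_one_one (D := D) (f := f) y]
  refine planeVec_congr y (fun h => ?_) fun h => ?_
  · have hs := Complex.ofReal_ne_zero.2 (sin_ne_zero_of_frac_pos (sin_angle_sq D f) h)
    field_simp
    linear_combination (2 * Real.sin (angle D f) : ℂ) * Complex.I_sq
  · have hc := Complex.ofReal_ne_zero.2 (cos_ne_zero_of_frac_lt_one (sin_angle_sq D f) h)
    field_simp
    ring

theorem sum_smul_iter_pow_mulVec_startAD {T : ℕ} (hT : T ≠ 0) (α : ℝ) :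
    ∑ m ∈ Finset.range T, Complex.exp (Complex.I * α) ^ m • (iter D y f ^ m *ᵥ startAD n k) =
      (T * (Complex.exp (angle D f * Complex.I) * phaseAmp T (α + (π + 2 * angle D f))) / 2) •
          groverEigenvec D y f (angle D f) +
        (T * (Complex.exp (-angle D f * Complex.I) * phaseAmp T (α + (π + 2 * -angle D f))) / 2) •
          groverEigenvec D y f (-angle D f) := by
  have hneg : Real.sin (-angle D f) ^ 2 = frac D f := by
    rw [Real.sin_neg, neg_sq, sin_angle_sq]
  have hsmul (c : ℂ) (v : AD n k → ℂ) :
      ∑ m ∈ Finset.range T, Complex.exp (Complex.I * α) ^ m • (iter D y f ^ m *ᵥ (c • v)) =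
        c • ∑ m ∈ Finset.range T, Complex.exp (Complex.I * α) ^ m • (iter D y f ^ m *ᵥ v) := by
    simp only [mulVec_smul, Finset.smul_sum]
    exact Finset.sum_congr rfl fun m _ => smul_comm _ _ _
  rw [startAD_eq_groverEigenvec_add (D := D) (f := f) y]
  simp only [mulVec_add, smul_add, Finset.sum_add_distrib, hsmul,
    sum_smul_iter_pow_mulVec_groverEigenvec y (sin_angle_sq D f) hT,
    sum_smul_iter_pow_mulVec_groverEigenvec y hneg hT, smul_smul]
  ring_nf

theorem sum_norm_sq_smul_groverEigenvec_add (a b : ℂ)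
    (hfrac0 : frac D f = 0 → a = b) (hfrac1 : frac D f = 1 → a = -b) :
    ∑ s, ‖(a • groverEigenvec D y f (angle D f) + b • groverEigenvec D y f (-angle D f)) s‖ ^ 2 =
      2 * (‖a‖ ^ 2 + ‖b‖ ^ 2) := by
  have hcos : Real.cos (angle D f) ^ 2 = 1 - frac D f := by rw [Real.cos_sq', sin_angle_sq]
  have hA : a * (-Complex.I / Real.sin (angle D f)) +
      b * (-Complex.I / Real.sin (-angle D f)) = -Complex.I * (a - b) / Real.sin (angle D f) := by
    rw [Real.sin_neg, Complex.ofReal_neg]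
    ring
  have hB : a * (1 / Real.cos (angle D f)) + b * (1 / Real.cos (-angle D f)) =
      (a + b) / Real.cos (angle D f) := by
    rw [Real.cos_neg]
    ring
  rw [groverEigenvec, groverEigenvec, smul_planeVec, smul_planeVec, planeVec_add_planeVec,
    sum_norm_sq_planeVec, hA, hB, norm_div, norm_div, div_pow, div_pow, Complex.norm_real,
    Complex.norm_real, Real.norm_eq_abs, Real.norm_eq_abs, sq_abs, sq_abs, sin_angle_sq, hcos,
    mul_div_cancel_of_imp', mul_div_cancel_of_imp', norm_mul, norm_neg, Complex.norm_I, one_mul]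
  · have := parallelogram_law_with_norm ℝ a b
    linarith
  · intro h
    rw [hfrac1 (by linarith), neg_add_cancel, norm_zero, zero_pow two_ne_zero]
  · intro h
    rw [hfrac0 h, sub_self, mul_zero, norm_zero, zero_pow two_ne_zero]

theorem sum_norm_sq_sum_smul_iter_pow {T : ℕ} (hT : T ≠ 0) (α : ℝ) :
    ∑ s, ‖(∑ m ∈ Finset.range T,
        Complex.exp (Complex.I * α) ^ m • (iter D y f ^ m *ᵥ startAD n k)) s‖ ^ 2 =
      T ^ 2 * ((‖phaseAmp T (α + (π + 2 * angle D f))‖ ^ 2 +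
        ‖phaseAmp T (α + (π + 2 * -angle D f))‖ ^ 2) / 2) := by
  rw [sum_smul_iter_pow_mulVec_startAD y hT, sum_norm_sq_smul_groverEigenvec_add]
  · have hnorm (ψ : ℝ) : ‖Complex.exp (ψ * Complex.I)‖ = 1 := Complex.norm_exp_ofReal_mul_I ψ
    rw [← Complex.ofReal_neg]
    simp only [norm_div, norm_mul, hnorm, Complex.norm_natCast, Complex.norm_ofNat]
    ring
  · intro h
    simp [angle, h]
  · intro h
    have hangle : angle D f = π / 2 := by rw [angle, h, Real.sqrt_one, Real.arcsin_one]
    have hperiod : phaseAmp T (α + (π + 2 * (π / 2))) = phaseAmp T (α + (π + 2 * -(π / 2))) := by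
      rw [← phaseAmp_add_int_mul_two_pi T (α + (π + 2 * -(π / 2))) 1]
      congr 1
      push_cast
      ring
    have hexp : Complex.exp ((π / 2 : ℝ) * Complex.I) =
        -Complex.exp (-(π / 2 : ℝ) * Complex.I) := by
      rw [neg_mul, Complex.exp_neg, Complex.ofReal_div, Complex.ofReal_ofNat,
        Complex.exp_pi_div_two_mul_I, Complex.inv_I, neg_neg]
    rw [hangle, hperiod, hexp]
    ring

end Grover

/-! ### The rounds of the protocol -/

section Rounds

theorem kronecker_mulVec_mul {ι κ R : Type*} [Fintype ι] [Fintype κ] [CommSemiring R]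
    (A : Matrix ι ι R) (B : Matrix κ κ R) (u : ι → R) (v : κ → R) :
    (A ⊗ₖ B) *ᵥ (fun s => u s.1 * v s.2) = fun s => (A *ᵥ u) s.1 * (B *ᵥ v) s.2 := by
  funext s
  simp only [mulVec, dotProduct, kroneckerMap_apply]
  rw [Fintype.sum_prod_type, Finset.sum_mul_sum]
  exact Finset.sum_congr rfl fun _ _ => Finset.sum_congr rfl fun _ _ => mul_mul_mul_comm _ _ _ _

theorem blockDiagonal_mulVec_apply {ι κ R : Type*} [Fintype ι] [Fintype κ] [DecidableEq κ]
    [NonUnitalNonAssocSemiring R] (A : κ → Matrix ι ι R) (v : ι × κ → R) (i : ι) (j : κ) :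
    (blockDiagonal A *ᵥ v) (i, j) = (A j *ᵥ fun i' => v (i', j)) i := by
  simp only [mulVec, dotProduct, Fintype.sum_prod_type, blockDiagonal_apply, ite_mul, zero_mul,
    Finset.sum_ite_eq, Finset.mem_univ, if_true]

variable {n k t : ℕ}

theorem onFst_mulVec (A : Matrix (Copy n k t) (Copy n k t) ℂ) (u v : Copy n k t → ℂ) :
    onFst A *ᵥ (fun s => u s.1 * v s.2) = fun s => (A *ᵥ u) s.1 * v s.2 := by
  rw [onFst, kronecker_mulVec_mul, one_mulVec]

theorem onSnd_mulVec (A : Matrix (Copy n k t) (Copy n k t) ℂ) (u v : Copy n k t → ℂ) :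
    onSnd A *ᵥ (fun s => u s.1 * v s.2) = fun s => u s.1 * (A *ᵥ v) s.2 := by
  rw [onSnd, kronecker_mulVec_mul, one_mulVec]

theorem onAD_mulVec_apply (A : Matrix (AD n k) (AD n k) ℂ) (v : Copy n k t → ℂ) (a : AD n k)
    (c : Bits t) (b : ZMod 2) :
    (onAD t A *ᵥ v) ((a, c), b) = (A *ᵥ fun a' => v ((a', c), b)) a := by
  rw [onAD, blockDiagonal_mulVec_apply, blockDiagonal_mulVec_apply]

theorem controlled_mulVec_apply (i : ℕ) (A : Matrix (AD n k) (AD n k) ℂ) (v : Copy n k t → ℂ)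
    (a : AD n k) (c : Bits t) (b : ZMod 2) :
    (controlled t i A *ᵥ v) ((a, c), b) =
      ((if ∃ w, InBlock w i ∧ c w = 1 then A else 1) *ᵥ fun a' => v ((a', c), b)) a := by
  rw [controlled, blockDiagonal_mulVec_apply, blockDiagonal_mulVec_apply]

/-- The operation on the address and data registers in the rounds `0, …, i - 1`, if the control
register is in the state `|c⟩`. -/
noncomputable def roundsEffect (D : Database n k) (y : Bits n) (fs : ℕ → Bits k → ZMod 2)
    (c : Bits t) : ℕ → Matrix (AD n k) (AD n k) ℂ
  | 0 => 1
  | i + 1 => (if ∃ w, InBlock w i ∧ c w = 1 then iter D y (fs i) else 1) * roundsEffect D y fs c i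

/-- The state of one copy after the rounds `0, …, i - 1`. -/
noncomputable def copyState (t : ℕ) (D : Database n k) (y : Bits n) (fs : ℕ → Bits k → ZMod 2)
    (i : ℕ) : Copy n k t → ℂ :=
  fun s => plusKet t s.1.2 * ket (0 : ZMod 2) s.2 *
    (roundsEffect D y fs s.1.2 i *ᵥ startAD n k) s.1.1

variable (D : Database n k) (y : Bits n) (fs : ℕ → Bits k → ZMod 2)

theorem copyState_zero : copyState t D y fs 0 = initCopy n k t := by
  funext s
  rw [copyState, initCopy, roundsEffect, one_mulVec, startAD]
  ring

theorem copyState_succ (i : ℕ) :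
    copyState t D y fs (i + 1) =
      (controlled t i (Gbar n k) * onAD t (UD D y)) *ᵥ
        (controlled t i (Uf n (fs i)) * onAD t (UD D y)) *ᵥ copyState t D y fs i := by
  have hsmul (A : Matrix (AD n k) (AD n k) ℂ) (z : ℂ) (u : AD n k → ℂ) :
      (A *ᵥ fun a => z * u a) = fun a => z * (A *ᵥ u) a := mulVec_smul A z u
  funext ⟨⟨a, c⟩, b⟩
  simp only [← mulVec_mulVec, controlled_mulVec_apply, onAD_mulVec_apply, copyState, hsmul,
    roundsEffect]
  congr 1
  split_ifs
  · simp only [iter, ← mulVec_mulVec]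
  · simp only [one_mulVec, UD_mulVec, add_add_cancel_bits]

theorem stateAfter_eq_mul (i : ℕ) :
    stateAfter t D y fs i = fun s => copyState t D y fs i s.1 * copyState t D y fs i s.2 := by
  induction i with
  | zero => rw [stateAfter, copyState_zero]
  | succ i ih =>
    rw [stateAfter, ih, groverRound, copyState_succ, ← mulVec_mulVec, onFst_mulVec,
      ← mulVec_mulVec, onSnd_mulVec, ← mulVec_mulVec, onFst_mulVec, onSnd_mulVec]

/-- The first round that belongs to the control qubit `C_j`, and `2 ^ t` for `j = t`. -/
def blockStart (t j : ℕ) : ℕ :=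
  2 ^ t - 2 ^ (t - j) + 1

theorem blockStart_zero (t : ℕ) : blockStart t 0 = 1 := by
  rw [blockStart, Nat.sub_zero, Nat.sub_self]

theorem blockStart_self (t : ℕ) : blockStart t t = 2 ^ t := by
  rw [blockStart, Nat.sub_self, pow_zero, Nat.sub_add_cancel Nat.one_le_two_pow]

theorem blockStart_succ {j : ℕ} (hj : j < t) :
    blockStart t (j + 1) = blockStart t j + 2 ^ (t - j - 1) := by
  have hle : 2 ^ (t - j) ≤ 2 ^ t := Nat.pow_le_pow_right two_pos (Nat.sub_le t j)
  have hdouble : 2 ^ (t - j) = 2 * 2 ^ (t - j - 1) := by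
    rw [← pow_succ', Nat.sub_add_cancel (Nat.sub_pos_of_lt hj)]
  rw [blockStart, blockStart, ← Nat.sub_sub]
  omega

theorem blockStart_mono (t : ℕ) : Monotone (blockStart t) := fun _ _ h =>
  Nat.add_le_add_right (Nat.sub_le_sub_left (Nat.pow_le_pow_right two_pos
    (Nat.sub_le_sub_left h t)) _) 1

theorem inBlock_iff (w : Fin t) (i : ℕ) :
    InBlock w i ↔ blockStart t w ≤ i ∧ i < blockStart t (w + 1) := by
  rw [InBlock, blockStart, blockStart, Nat.succ_le_iff, Nat.lt_succ_iff, Nat.sub_sub]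

theorem inBlock_blockStart_add_iff {w : Fin t} {l : ℕ} (hl : l < 2 ^ (t - w.val - 1))
    (v : Fin t) : InBlock v (blockStart t w + l) ↔ v = w := by
  have hend := blockStart_succ w.isLt
  rw [inBlock_iff]
  constructor
  · rintro ⟨hv, hv'⟩
    by_contra hne
    rcases lt_or_gt_of_ne hne with h | h
    · have := blockStart_mono t (Nat.add_one_le_of_lt (Fin.lt_def.1 h))
      omega
    · have := blockStart_mono t (Nat.add_one_le_of_lt (Fin.lt_def.1 h))
      omega
  · rintro rfl
    omega

theorem roundsEffect_blockStart_add (c : Bits t) (w : Fin t) {l : ℕ}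
    (hl : l ≤ 2 ^ (t - w.val - 1)) :
    roundsEffect D y fs c (blockStart t w + l) =
      (if c w = 1 then effect D y (fun l => fs (blockStart t w + l)) l else 1) *
        roundsEffect D y fs c (blockStart t w) := by
  induction l with
  | zero => rw [effect, ite_self, Matrix.one_mul, Nat.add_zero]
  | succ l ih =>
    have hiff : (∃ v, InBlock v (blockStart t w + l) ∧ c v = 1) ↔ c w = 1 := by
      simp only [inBlock_blockStart_add_iff hl, exists_eq_left]
    rw [← Nat.add_assoc, roundsEffect, ih (Nat.le_of_succ_le hl), if_congr hiff rfl rfl]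
    split_ifs
    · rw [effect, Matrix.mul_assoc]
    · rw [Matrix.one_mul]

theorem roundsEffect_blockStart_succ (c : Bits t) (w : Fin t) :
    roundsEffect D y fs c (blockStart t (w + 1)) =
      (if c w = 1 then blockEffect D y fs w else 1) *
        roundsEffect D y fs c (blockStart t w) := by
  rw [blockStart_succ w.isLt, roundsEffect_blockStart_add D y fs c w le_rfl]
  rfl

theorem roundsEffect_one (c : Bits t) : roundsEffect D y fs c 1 = 1 := by
  rw [roundsEffect, roundsEffect, if_neg, Matrix.one_mul]
  rintro ⟨w, hw, -⟩
  exact Nat.not_lt_zero _ hw.1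

theorem eq_pow_sum_of_succ {M : Type*} [Monoid M] (a : M) (P : ℕ → M) (e : Fin t → ℕ)
    (hzero : P 0 = 1) (hsucc : ∀ w : Fin t, P (w + 1) = a ^ e w * P w) :
    P t = a ^ ∑ w, e w := by
  induction t with
  | zero => rw [hzero, Fin.sum_univ_zero, pow_zero]
  | succ t ih =>
    have hinit := ih (fun w => e w.castSucc) fun w => hsucc w.castSucc
    have hlast := hsucc (Fin.last t)
    rw [Fin.val_last, hinit, ← pow_add] at hlast
    rw [hlast, Fin.sum_univ_castSucc, add_comm]

theorem roundsEffect_two_pow (Q : Matrix (AD n k) (AD n k) ℂ) (M : Finset (Fin t))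
    (hQ : ∀ w, blockEffect D y fs w =
      if w ∈ M then Q ^ 2 ^ (M.filter (fun v => w < v)).card else 1) (c : Bits t) :
    roundsEffect D y fs c (2 ^ t) = Q ^ binVal M c := by
  have hsum : binVal M c =
      ∑ w, if w ∈ M then (c w).val * 2 ^ (M.filter (fun v => w < v)).card else 0 := by
    rw [Finset.sum_ite_mem, Finset.univ_inter, binVal]
  rw [← blockStart_self, hsum]
  refine eq_pow_sum_of_succ Q (fun j => roundsEffect D y fs c (blockStart t j)) _ ?_ fun w => ?_
  · rw [blockStart_zero, roundsEffect_one]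
  · rw [roundsEffect_blockStart_succ, hQ]
    rcases eq_zero_or_eq_one_zmod_two (c w) with h | h <;> by_cases hw : w ∈ M <;>
      simp [h, hw, ZMod.val_one]

theorem effect_eq_pow {f : Bits k → ZMod 2} {g : ℕ → Bits k → ZMod 2} {L : ℕ}
    (h : ∀ l < L, g l = f) : effect D y g L = iter D y f ^ L := by
  induction L with
  | zero => rfl
  | succ L ih =>
    rw [effect, ih fun l hl => h l (hl.trans L.lt_succ_self), h L L.lt_succ_self, pow_succ']

theorem blockEffect_eq_pow {f : Bits k → ZMod 2} {w : Fin t} (h : ∀ i, InBlock w i → fs i = f) :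
    blockEffect D y fs w = iter D y f ^ 2 ^ (t - w.val - 1) :=
  effect_eq_pow D y fun _ hl => h _ ((inBlock_blockStart_add_iff hl w).2 rfl)

theorem card_filter_lt (w : Fin t) : (Finset.univ.filter fun v => w < v).card = t - w.val - 1 := by
  rw [Finset.filter_lt_eq_Ioi, Fin.card_Ioi, Nat.sub_right_comm]

variable {D} {fs}

theorem InBlock.lt_two_pow {w : Fin t} {i : ℕ} (h : InBlock w i) : i < 2 ^ t :=
  ((inBlock_iff w i).1 h).2.trans_le
    ((blockStart_mono t (Nat.succ_le_of_lt w.isLt)).trans_eq (blockStart_self t))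

theorem IsStrategy.blockEffect_eq {f : Bits k → ZMod 2} {conf : Option (Fin t)}
    (h : IsStrategy D f fs conf) (w : Fin t) :
    blockEffect D y fs w = if w ∈ readQubits conf then
      iter D y f ^ 2 ^ ((readQubits conf).filter fun v => w < v).card else 1 := by
  cases conf with
  | none =>
    rw [readQubits, if_pos (Finset.mem_univ w), card_filter_lt]
    exact blockEffect_eq_pow D y fs fun i hi => h i hi.lt_two_pow
  | some u =>
    obtain ⟨-, hbefore, hconf, hafter⟩ := h
    rw [readQubits, Finset.filter_erase]
    rcases lt_trichotomy w u with hwu | rfl | huw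
    · rw [if_pos (Finset.mem_erase.2 ⟨hwu.ne, Finset.mem_univ w⟩),
        Finset.card_erase_of_mem (Finset.mem_filter.2 ⟨Finset.mem_univ u, hwu⟩), card_filter_lt,
        hbefore w hwu, Nat.sub_sub (t - w.val)]
    · rw [if_neg (Finset.notMem_erase w _), hconf]
    · rw [if_pos (Finset.mem_erase.2 ⟨huw.ne', Finset.mem_univ w⟩),
        Finset.erase_eq_of_notMem fun hu => huw.not_gt (Finset.mem_filter.1 hu).2, card_filter_lt,
        blockEffect_eq_pow D y fs (hafter w huw)]

theorem IsStrategy.roundsEffect_eq {f : Bits k → ZMod 2} {conf : Option (Fin t)}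
    (h : IsStrategy D f fs conf) (c : Bits t) :
    roundsEffect D y fs c (2 ^ t) = iter D y f ^ binVal (readQubits conf) c :=
  roundsEffect_two_pow D y fs _ _ (h.blockEffect_eq y) c

end Rounds

/-! ### The outcomes of the protocol -/

section Outcome

variable {n k t : ℕ}

theorem sum_qft_mul (M : Finset (Fin t)) (c' : Bits t) (g : ℕ → ℂ) :
    ∑ c, qft M c' c * g (binVal M c) =
      ((√(2 ^ M.card : ℝ) : ℝ) : ℂ)⁻¹ * ∑ m ∈ Finset.range (2 ^ M.card),
        Complex.exp (Complex.I * ((2 * π * binVal M c' / (2 ^ M.card : ℕ) : ℝ) : ℂ)) ^ m * g m := by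
  rw [← sum_agree_binVal M _ c', Finset.mul_sum]
  refine Finset.sum_congr rfl fun c _ => ?_
  rw [qft, of_apply]
  split_ifs
  · rw [← Complex.exp_nat_mul, mul_assoc]
    congr 3
    push_cast
    ring
  · rw [zero_mul, mul_zero]

theorem fourier_mulVec_apply (M : Finset (Fin t)) (v : Copy n k t → ℂ) (a : AD n k) (c' : Bits t)
    (b : ZMod 2) : (fourier n k M *ᵥ v) ((a, c'), b) = ∑ c, qft M c' c * v ((a, c), b) := by
  rw [fourier, kronecker_one_mulVec_apply]
  simp only [mulVec, dotProduct, Fintype.sum_prod_type (α₁ := AD n k), kroneckerMap_apply]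
  rw [Finset.sum_eq_single a (fun a' _ ha => by simp only [one_apply_ne ha.symm, zero_mul,
    Finset.sum_const_zero]) (by simp)]
  simp only [one_apply_eq, one_mul]

theorem Uf'_mulVec (f : Bits k → ZMod 2) (v : Copy n k t → ℂ) :
    Uf' n t f *ᵥ v = fun s => v (s.1, s.2 + f s.1.1.2) :=
  permGate_mulVec (involutive_ancilla fun s : AD n k × Bits t => f s.1.2) v

/-- The state of one copy right before the final measurements. -/
noncomputable def copyFinal (D : Database n k) (y : Bits n) (f : Bits k → ZMod 2)
    (fs : ℕ → Bits k → ZMod 2) (M : Finset (Fin t)) : Copy n k t → ℂ :=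
  fourier n k M *ᵥ onAD t (UD D y) *ᵥ (Uf' n t f * onAD t (UD D y)) *ᵥ copyState t D y fs (2 ^ t)

variable (D : Database n k) (y : Bits n) (f : Bits k → ZMod 2) (fs : ℕ → Bits k → ZMod 2)

theorem finalState_eq_mul (M : Finset (Fin t)) :
    finalState D y f fs M = fun s => copyFinal D y f fs M s.1 * copyFinal D y f fs M s.2 := by
  unfold finalState copyFinal
  rw [stateAfter_eq_mul]
  simp only [← mulVec_mulVec, onFst_mulVec, onSnd_mulVec]

theorem copyFinal_apply (M : Finset (Fin t)) (a : AD n k) (c' : Bits t) (b : ZMod 2) :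
    copyFinal D y f fs M ((a, c'), b) = ket (0 : ZMod 2) (b + f (a.2 + D (a.1 + y))) *
      ∑ c, qft M c' c * (plusKet t c * (roundsEffect D y fs c (2 ^ t) *ᵥ startAD n k) a) := by
  rw [copyFinal, fourier_mulVec_apply, Finset.mul_sum]
  refine Finset.sum_congr rfl fun c _ => ?_
  simp only [← mulVec_mulVec, onAD_mulVec_apply, UD_mulVec, Uf'_mulVec, copyState,
    add_add_cancel_bits]
  ring

variable {D f fs} {conf : Option (Fin t)}

theorem IsStrategy.copyFinal_apply (h : IsStrategy D f fs conf) (a : AD n k) (c' : Bits t)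
    (b : ZMod 2) :
    copyFinal D y f fs (readQubits conf) ((a, c'), b) =
      ket (0 : ZMod 2) (b + f (a.2 + D (a.1 + y))) *
        (((√(2 ^ (readQubits conf).card : ℝ) : ℝ) : ℂ)⁻¹ * (((√(2 ^ t : ℝ) : ℝ) : ℂ)⁻¹ *
          (∑ m ∈ Finset.range (2 ^ (readQubits conf).card),
            Complex.exp (Complex.I * ((2 * π * binVal (readQubits conf) c' /
              (2 ^ (readQubits conf).card : ℕ) : ℝ) : ℂ)) ^ m •
                (iter D y f ^ m *ᵥ startAD n k)) a)) := by
  simp only [QCount.copyFinal_apply, h.roundsEffect_eq, plusKet]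
  rw [sum_qft_mul _ _ fun m => ((√(2 ^ t : ℝ) : ℝ) : ℂ)⁻¹ * (iter D y f ^ m *ᵥ startAD n k) a,
    Finset.sum_apply, Finset.mul_sum (a := ((√(2 ^ t : ℝ) : ℝ) : ℂ)⁻¹)]
  simp only [Pi.smul_apply, smul_eq_mul, mul_left_comm]

/-- The probability of the outcome `θ` of phase estimation on `T` states for the eigenvalues
`-exp (± 2 i φ)`, if both eigenvectors are equally likely. -/
noncomputable def outcomeProb (T : ℕ) (φ : ℝ) (θ : ℕ) : ℝ :=
  (‖phaseAmp T (2 * π * θ / T + (π + 2 * φ))‖ ^ 2 +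
    ‖phaseAmp T (2 * π * θ / T + (π + 2 * -φ))‖ ^ 2) / 2

theorem sum_outcomeProb {T : ℕ} (hT : 0 < T) (φ : ℝ) :
    ∑ θ ∈ Finset.range T, outcomeProb T φ θ = 1 := by
  simp only [outcomeProb, ← Finset.sum_div, Finset.sum_add_distrib, sum_norm_phaseAmp_sq hT]
  norm_num

theorem sum_norm_sq_ket_add (z : ZMod 2) : ∑ b, ‖ket (0 : ZMod 2) (b + z)‖ ^ 2 = 1 := by
  rw [← sum_norm_sq_ket (0 : ZMod 2)]
  exact Equiv.sum_comp (Equiv.addRight z) fun b => ‖ket (0 : ZMod 2) b‖ ^ 2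

theorem IsStrategy.sum_norm_sq_copyFinal_apply (h : IsStrategy D f fs conf) (c' : Bits t) :
    ∑ a, ∑ b, ‖copyFinal D y f fs (readQubits conf) ((a, c'), b)‖ ^ 2 =
      2 ^ (readQubits conf).card / 2 ^ t *
        outcomeProb (2 ^ (readQubits conf).card) (angle D f) (binVal (readQubits conf) c') := by
  simp only [h.copyFinal_apply, norm_mul, norm_inv, Complex.norm_real, Real.norm_eq_abs, mul_pow,
    inv_pow, sq_abs, ← Finset.sum_mul, sum_norm_sq_ket_add, one_mul, ← Finset.mul_sum]
  rw [sum_norm_sq_sum_smul_iter_pow y (pow_ne_zero _ two_ne_zero), outcomeProb,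
    Real.sq_sqrt (by positivity), Real.sq_sqrt (by positivity)]
  push_cast
  field_simp

theorem IsStrategy.sum_ite_norm_sq_copyFinal (h : IsStrategy D f fs conf) (E : ℕ → Prop)
    [DecidablePred E] :
    ∑ s, (if E (binVal (readQubits conf) s.1.2) then
        ‖copyFinal D y f fs (readQubits conf) s‖ ^ 2 else 0) =
      ∑ θ ∈ Finset.range (2 ^ (readQubits conf).card),
        if E θ then outcomeProb (2 ^ (readQubits conf).card) (angle D f) θ else 0 := by
  have hcontrol (c' : Bits t) : ∑ a, ∑ b, (if E (binVal (readQubits conf) c') then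
      ‖copyFinal D y f fs (readQubits conf) ((a, c'), b)‖ ^ 2 else 0) =
      2 ^ (readQubits conf).card / 2 ^ t * if E (binVal (readQubits conf) c') then
        outcomeProb (2 ^ (readQubits conf).card) (angle D f) (binVal (readQubits conf) c')
        else 0 := by
    split_ifs
    · exact h.sum_norm_sq_copyFinal_apply y c'
    · simp only [Finset.sum_const_zero, mul_zero]
  rw [Fintype.sum_prod_type, Fintype.sum_prod_type, Finset.sum_comm]
  simp only [hcontrol]
  rw [← Finset.mul_sum, sum_binVal (readQubits conf) fun θ =>
    if E θ then outcomeProb (2 ^ (readQubits conf).card) (angle D f) θ else 0]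
  field_simp

theorem IsStrategy.sum_norm_sq_copyFinal (h : IsStrategy D f fs conf) :
    ∑ s, ‖copyFinal D y f fs (readQubits conf) s‖ ^ 2 = 1 := by
  rw [← sum_outcomeProb (pow_pos two_pos (readQubits conf).card) (angle D f)]
  simpa only [if_true] using h.sum_ite_norm_sq_copyFinal y fun _ => True

theorem sum_ite_apply_norm_sq_mul {ι α : Type*} [Fintype ι] {φ : ι → ℂ}
    (hφ : ∑ s, ‖φ s‖ ^ 2 = 1) (e : ι → α) (P : α → Prop) [DecidablePred P] (i : Fin 2) :
    (∑ s : ι × ι, if P (![e s.1, e s.2] i) then ‖φ s.1 * φ s.2‖ ^ 2 else 0) =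
      ∑ s, if P (e s) then ‖φ s‖ ^ 2 else 0 := by
  rw [Fintype.sum_prod_type]
  fin_cases i
  · simp only [Fin.zero_eta, Matrix.cons_val_zero, norm_mul, mul_pow, ← ite_zero_mul,
      ← Finset.mul_sum, hφ, mul_one]
  · rw [Finset.sum_comm]
    simp only [Fin.mk_one, Matrix.cons_val_one, Matrix.cons_val_fin_one, norm_mul, mul_pow,
      ← mul_ite_zero, ← Finset.sum_mul, hφ, one_mul]

end Outcome

section Protocol

variable {n k t : ℕ} [NeZero n] [NeZero k] {D : Database n k} {f : Bits k → ZMod 2}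
  {fs : ℕ → Bits k → ZMod 2} {conf : Option (Fin t)} {p : ℝ}

open Classical in
theorem protocolProb_eq_sum (E : (Fin 2 → ℝ) → Prop) :
    protocolProb p D f fs conf E = 1 / 2 ^ n * ∑ y : Bits n, ∑ s : Joint n k t,
      if E ![estimate (readQubits conf) s.1, estimate (readQubits conf) s.2]
        then ‖finalState D y f fs (readQubits conf) s‖ ^ 2 else 0 := by
  simp only [protocolProb, passTest1_eq_one, passTest2_eq_one, survive_one,
    Finset.prod_const_one, one_mul]

theorem protocolProb_mono {E E' : (Fin 2 → ℝ) → Prop} (h : ∀ s, E s → E' s) :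
    protocolProb p D f fs conf E ≤ protocolProb p D f fs conf E' := by
  rw [protocolProb_eq_sum, protocolProb_eq_sum]
  gcongr with y _ s _
  split_ifs with hE hE'
  · exact le_rfl
  · exact absurd (h _ hE) hE'
  · positivity
  · exact le_rfl

open Classical in
theorem IsStrategy.protocolProb_apply (h : IsStrategy D f fs conf) (P : ℝ → Prop) (i : Fin 2) :
    protocolProb p D f fs conf (fun s => P (s i)) =
      ∑ θ ∈ Finset.range (2 ^ (readQubits conf).card),
        if P (Real.cos (θ * π / 2 ^ (readQubits conf).card) ^ 2) then
          outcomeProb (2 ^ (readQubits conf).card) (angle D f) θ else 0 := by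
  have hy (y : Bits n) := (sum_ite_apply_norm_sq_mul (h.sum_norm_sq_copyFinal y)
    (estimate (readQubits conf)) P i).trans (h.sum_ite_norm_sq_copyFinal y fun θ =>
      P (Real.cos (θ * π / 2 ^ (readQubits conf).card) ^ 2))
  have hcard : ((Fintype.card (Bits n) : ℕ) : ℝ) = 2 ^ n := by
    simp only [Fintype.card_fun, ZMod.card, Fintype.card_fin, Nat.cast_pow, Nat.cast_ofNat]
  rw [protocolProb_eq_sum]
  simp only [finalState_eq_mul]
  rw [Finset.sum_congr rfl fun y _ => hy y, Finset.sum_const, Finset.card_univ, nsmul_eq_mul,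
    hcard, one_div, inv_mul_cancel_left₀ (by positivity)]

theorem IsStrategy.eight_div_pi_sq_le_protocolProb (h : IsStrategy D f fs conf) (i : Fin 2) :
    8 / π ^ 2 ≤ protocolProb p D f fs conf fun s =>
      |s i - frac D f| ≤ 2 * √(frac D f) * (π / 2 ^ (readQubits conf).card) +
        (π / 2 ^ (readQubits conf).card) ^ 2 := by
  classical
  set M := readQubits conf
  have hT : 0 < 2 ^ M.card := pow_pos two_pos _
  have hsign {ψ : ℝ} (hψ : |Real.sin ψ| = √(frac D f)) :
      8 / π ^ 2 ≤ ∑ θ ∈ Finset.range (2 ^ M.card),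
        if |Real.cos (θ * π / 2 ^ M.card) ^ 2 - frac D f| ≤
            2 * √(frac D f) * (π / 2 ^ M.card) + (π / 2 ^ M.card) ^ 2 then
          ‖phaseAmp (2 ^ M.card) (2 * π * θ / (2 ^ M.card : ℕ) + (π + 2 * ψ))‖ ^ 2 else 0 := by
    refine (eight_div_pi_sq_le_sum_nearPhaseProb hT (π + 2 * ψ)).trans
      (Finset.sum_le_sum fun θ _ => nearPhaseProb_le_ite fun hnear => ?_)
    rw [← hψ, ← Real.sq_sqrt (frac_nonneg D f), ← hψ, sq_abs]
    refine abs_cos_sq_sub_sin_sq_le ?_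
    convert hnear using 1 <;> push_cast <;> ring
  rw [h.protocolProb_apply (fun v => |v - frac D f| ≤
    2 * √(frac D f) * (π / 2 ^ M.card) + (π / 2 ^ M.card) ^ 2)]
  have hpos := hsign (ψ := angle D f) (by rw [sin_angle, abs_of_nonneg (Real.sqrt_nonneg _)])
  have hneg := hsign (ψ := -angle D f)
    (by rw [Real.sin_neg, abs_neg, sin_angle, abs_of_nonneg (Real.sqrt_nonneg _)])
  calc 8 / π ^ 2 = (8 / π ^ 2 + 8 / π ^ 2) / 2 := (add_self_div_two _).symm
    _ ≤ _ := div_le_div_of_nonneg_right (add_le_add hpos hneg) two_pos.le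
    _ = _ := by
      rw [← Finset.sum_add_distrib, Finset.sum_div]
      refine Finset.sum_congr rfl fun θ _ => ?_
      rw [outcomeProb]
      split_ifs
      · rfl
      · norm_num

end Protocol

theorem lt_two_pow_card_readQubits {t : ℕ} {conf : Option (Fin t)} {r : ℝ}
    (hnone : conf = none → r < 2 ^ t) (hsome : conf ≠ none → 2 * r < 2 ^ t) :
    r < 2 ^ (readQubits conf).card := by
  cases conf with
  | none => simpa only [readQubits, Finset.card_univ, Fintype.card_fin] using hnone rfl
  | some u =>
    have hdouble : (2 : ℝ) ^ t = 2 * 2 ^ (t - 1) := by rw [← pow_succ', Nat.sub_add_cancel u.pos]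
    have hr := hsome (Option.some_ne_none u)
    rw [hdouble] at hr
    rw [readQubits, Finset.card_erase_of_mem (Finset.mem_univ u), Finset.card_univ,
      Fintype.card_fin]
    exact lt_of_mul_lt_mul_left hr two_pos.le

end QCount

theorem mainTheorem4 (n k t : ℕ) [NeZero n] [NeZero k]
    (D : Database n k) (f : Bits k → ZMod 2)
    (fs : ℕ → Bits k → ZMod 2) (conf : Option (Fin t)) (hfs : IsStrategy D f fs conf)
    (p : ℝ) (hp : p ∈ Set.Ioo (0 : ℝ) 1) (smin : ℝ) (hsmin : 0 < smin)
    (hT : conf = none → 100 / √smin < (2 : ℝ) ^ t)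
    (hT' : conf ≠ none → 200 / √smin < (2 : ℝ) ^ t)
    (i : Fin 2) :
    8 / Real.pi ^ 2 ≤ protocolProb p D f fs conf (fun s =>
      (smin ≤ frac D f →
        |s i / frac D f - 1| <
          2 * Real.pi / 100 * √(smin / frac D f) + Real.pi ^ 2 / 10 ^ 4 * (smin / frac D f) ∧
        2 * Real.pi / 100 * √(smin / frac D f) + Real.pi ^ 2 / 10 ^ 4 * (smin / frac D f) < 0.07) ∧
      (frac D f < smin →
        |s i - frac D f| / smin <
          2 * Real.pi / 100 * √(frac D f / smin) + Real.pi ^ 2 / 10 ^ 4 ∧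
        2 * Real.pi / 100 * √(frac D f / smin) + Real.pi ^ 2 / 10 ^ 4 < 0.07)) ∧
    8 / Real.pi ^ 2 > 0.8 := by
  have hcard : 100 / √smin < 2 ^ (readQubits conf).card :=
    lt_two_pow_card_readQubits hT fun hconf => by
      rw [mul_div_assoc']
      norm_num
      exact hT' hconf
  have hη : Real.pi / 2 ^ (readQubits conf).card < Real.pi / 100 * √smin := by
    rw [div_lt_iff₀ (Real.sqrt_pos.2 hsmin)] at hcard
    rw [div_lt_iff₀ (by positivity)]
    nlinarith [Real.pi_pos]
  refine ⟨(hfs.eight_div_pi_sq_le_protocolProb i).trans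
    (protocolProb_mono fun s hs => error_bounds_of_abs_sub_le hsmin (by positivity) hη hs), ?_⟩
  rw [gt_iff_lt, lt_div_iff₀ (by positivity)]
  nlinarith [Real.pi_pos, Real.pi_lt_d2]
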